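/- **Lemma 3.1.** Let $\alpha_1>\alpha_2>\dots>\alpha_N\ge 1$ and $m_1,\dots,m_N\in\mathbb N$. For matrices $A_0,\dots,A_{\beta-1}$ of equal size let $T(A_0,\dots,A_{\beta-1})$ be the $\beta\times\beta$ block upper-triangular Toeplitz matrix whose $(i,k)$ block is $A_{k-i}$ for $i\le k$ and $0$ for $i>k$. Let $$\mathcal B=\bigoplus_{r=1}^N T(B_0^r,\dots,B_{\alpha_r-1}^r),\quad \mathcal C=\bigoplus_{r=1}^N T(C_0^r,\dots,C_{\alpha_r-1}^r),\quad \mathcal F=\bigoplus_{r=1}^N E_{\alpha_r}(I_{m_r}),$$ where all $B_j^r,C_j^r\in\mathbb C^{m_r\times m_r}$ are symmetric, $B_0^r,C_0^r$ are nonsingular, and $E_\alpha(I_m)$ is the $\alpha\times\alpha$ block matrix with $I_m$ on the anti-diagonal and zeros elsewhere. Consider the solutions $\mathcal X$ of $$\mathcal C=\mathcal F\mathcal X^{T}\mathcal F\mathcal B\mathcal X \qquad (1)$$ of the form $\mathcal X=[\mathcal X_{rs}]_{r,s=1}^N$ with $$\mathcal X_{rs}=\begin{cases}[\,0\ \ \mathcal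 T_{rs}\,],&\alpha_r<\alpha_s\\ \begin{bmatrix}\mathcal T_{rs}\\0\end{bmatrix},&\alpha_r>\alpha_s\\ \mathcal T_{rs},&\alpha_r=\alpha_s\end{cases}\qquad \mathcal T_{rs}=T(A_0^{rs},\dots,A_{b_{rs}-1}^{rs}),\quad b_{rs}=\min\{\alpha_r,\alpha_s\},\quad A_j^{rs}\in\mathbb C^{m_r\times m_s}.\qquad (2)$$ The set of these solutions is nonempty, and it is a complex submanifold (of the space of all complex matrices of the size of $\mathcal X$) of dimension $$\sum_{r=1}^{N}\alpha_r m_r\Big(\tfrac12(m_r-1)+\sum_{s=1}^{r-1}m_s\Big).$$ Moreover, the solutions are described as follows. (a) $A_0^{rr}$ can be taken to be any solution of $C_0^r=(A_0^{rr})^TB_0^rA_0^{rr}$, $r\in\{1,\dots,N\}$, and the $A_j^{rs}$ with $r>s$, $0\le j\le\alpha_r-1$, can be chosen freely. (b) Given the choices in (a) and freely chosen skew-symmetric $Z_j^r=-(Z_j^r)^T\in\mathbb C^{m_r\times m_r}$ for $1\le j\le\alpha_r-1$, $r\in\{1,\dots,N\}$, the remaining $A_j^{rs}$ are computed by the following algorithm.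 Put $\Phi_n^{ks}=\sum_{l=0}^nB_{n-l}^kA_l^{ks}$, and $\Psi_n^{krs}=\sum_{i=0}^n(A_i^{kr})^T\Phi_{n-i}^{ks}$ for $n\ge0$, $\Psi_n^{krs}=0$ for $n<0$ (empty sums are $0$). For $j=0,1,\dots,\alpha_1-1$: * first, for all $r$ with $1\le j\le\alpha_r-1$, set $A_j^{rr}=A_0^{rr}(C_0^r)^{-1}\big(Z_j^r+\tfrac12(C_j^r-D_j^{rr})\big)$, where $$D_j^{rr}=\sum_{l=0}^{j-1}(A_0^{rr})^TB_{j-l}^rA_l^{rr}+\sum_{l=1}^{j-1}(A_l^{rr})^T\Phi_{j-l}^{rr}+\sum_{k=1}^{r-1}\Psi^{krr}_{j-\alpha_k+\alpha_r}+\sum_{k=r+1}^{N}\Psi^{krr}_{j-\alpha_r+\alpha_k};$$ * then, for $p=1,\dots,N-1$ and all $r$ with $s:=r+p\le N$ and $j\le\alpha_s-1$, set $A_j^{rs}=-A_0^{rr}(C_0^r)^{-1}D_j^{rs}$, where $$D_j^{rs}=\sum_{l=0}^{j-1}(A_0^{rr})^TB_{j-l}^rA_l^{rs}+\sum_{l=1}^{j}(A_l^{rr})^T\Phi_{j-l}^{rs}+\sum_{k=1}^{r-1}\Psi^{krs}_{j-\alpha_k+\alpha_r}+\sum_{k=r+1}^{s}\Psi^{krs}_{j}+\sum_{k=s+1}^{N}\Psi^{krs}_{j-\alpha_s+\alpha_k}.$$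 Each value is computed from values already known, and the choices in (a) and (b) correspond bijectively to the solutions of (1) of the form (2). Furthermore, let $\mathcal B$ and $\mathcal C$ be real. Then a real solution of the form (2) exists if and only if $B_0^r$ and $C_0^r$ have the same inertia for every $r\in\{1,\dots,N\}$. The solution given by a choice of the data in (a) and (b) is real if and only if (i) $B_0^r$ and $C_0^r$ have the same inertia for every $r$, and (ii) the chosen $A_0^{rr}$ $(1\le r\le N)$, $A_j^{rs}$ $(r>s,\ 0\le j\le\alpha_r-1)$ and $Z_j^r$ $(1\le j\le\alpha_r-1)$ are all real. -/

import Mathlib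

namespace ToeplitzEq

open Matrix

/-- `S` is a complex submanifold of dimension `d` of the complex normed space `E`: around each of
its points there is a biholomorphic chart of `E` which straightens `S` to a `d`-dimensional
complex linear subspace. -/
def IsComplexSubmanifold {E : Type*} [NormedAddCommGroup E] [NormedSpace ℂ E]
    (d : ℕ) (S : Set E) : Prop :=
  ∀ x ∈ S, ∃ (φ : OpenPartialHomeomorph E E) (L : Submodule ℂ E),
    x ∈ φ.source ∧ DifferentiableOn ℂ φ φ.source ∧ DifferentiableOn ℂ φ.symm φ.target ∧
    FiniteDimensional ℂ L ∧ Module.finrank ℂ L = d ∧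
    φ '' (S ∩ φ.source) = φ.target ∩ (L : Set E)

/-- All entries are real. -/
def IsRealMatrix {p q : Type*} (M : Matrix p q ℂ) : Prop := ∀ i j, (M i j).im = 0

open Classical in
/-- The inertia: the numbers of eigenvalues (with multiplicity) with positive, negative and zero
real part. -/
noncomputable def inertia {n : ℕ} (M : Matrix (Fin n) (Fin n) ℂ) : ℕ × ℕ × ℕ :=
  (Multiset.card (M.charpoly.roots.filter fun z => 0 < z.re),
   Multiset.card (M.charpoly.roots.filter fun z => z.re < 0),
   Multiset.card (M.charpoly.roots.filter fun z => z.re = 0))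

/-- The rectangular `a × b` block upper-triangular Toeplitz matrix with blocks `A 0, A 1, …`:
with `T = T(A 0, …, A (min a b - 1))` it is `[0 T]` if `a < b`, `T` stacked over `0` if `a > b`,
and `T` if `a = b`. (The subtraction `b - a` is truncated: it is the number of zero columns on
the left, which is `0` if `b ≤ a`.) -/
def rectToeplitz {p q : Type*} (a b : ℕ) (A : ℕ → Matrix p q ℂ) :
    Matrix (Fin a × p) (Fin b × q) ℂ :=
  fun x y => if x.1.val + (b - a) ≤ y.1.val
    then A (y.1.val - (x.1.val + (b - a))) x.2 y.2 else 0

/-- The `a × a` block matrix with identity matrices on the anti-diagonal. -/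
def antiDiag (a n : ℕ) : Matrix (Fin a × Fin n) (Fin a × Fin n) ℂ :=
  fun x y => if y.1 = Fin.rev x.1 ∧ x.2 = y.2 then 1 else 0

/-- Row and column indices of the big matrices: block `r` consists of `α r` blocks of size
`m r`. -/
abbrev Idx {N : ℕ} (α m : Fin N → ℕ) := (r : Fin N) × (Fin (α r) × Fin (m r))

/-- The blocks `A_j^{rs}`, as `A r s j`. -/
abbrev Coeffs {N : ℕ} (m : Fin N → ℕ) :=
  ∀ r s : Fin N, ℕ → Matrix (Fin (m r)) (Fin (m s)) ℂ

/-- The blocks `B_j^r`, as `B r j`. -/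
abbrev DiagCoeffs {N : ℕ} (m : Fin N → ℕ) :=
  ∀ r : Fin N, ℕ → Matrix (Fin (m r)) (Fin (m r)) ℂ

section

variable {N : ℕ} {α m : Fin N → ℕ}

/-- The block matrix `𝓧 = [𝓧_{rs}]` with rectangular block upper-triangular Toeplitz blocks. Only
the `A r s j` with `j < min (α r) (α s)` occur in it. -/
def blockToeplitz (α : Fin N → ℕ) (A : Coeffs m) : Matrix (Idx α m) (Idx α m) ℂ :=
  fun x y => rectToeplitz (α x.1) (α y.1) (A x.1 y.1) x.2 y.2

/-- The block diagonal matrix `⊕_r T(B_0^r, …, B_{α_r - 1}^r)`. -/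
def diagToeplitz (α : Fin N → ℕ) (B : DiagCoeffs m) : Matrix (Idx α m) (Idx α m) ℂ :=
  Matrix.blockDiagonal' fun r => rectToeplitz (α r) (α r) (B r)

/-- The matrix `𝓕 = ⊕_r E_{α_r}(I_{m_r})`. -/
def flipMatrix (α m : Fin N → ℕ) : Matrix (Idx α m) (Idx α m) ℂ :=
  Matrix.blockDiagonal' fun r => antiDiag (α r) (m r)

/-- The solutions of `𝓒 = 𝓕 𝓧ᵀ 𝓕 𝓑 𝓧` of block Toeplitz form. -/
def solutions (α : Fin N → ℕ) (B C : DiagCoeffs m) : Set (Matrix (Idx α m) (Idx α m) ℂ) :=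
  {X | (∃ A : Coeffs m, X = blockToeplitz α A) ∧
    diagToeplitz α C = flipMatrix α m * Xᵀ * flipMatrix α m * diagToeplitz α B * X}

/-- The data to be chosen: `diag r` is `A_0^{rr}`, `lower r s j` is `A_j^{rs}` for `s < r` and
`j < α_r`, and `skew r j` is `Z_j^r` for `1 ≤ j < α_r`. -/
structure Params (α m : Fin N → ℕ) where
  diag : ∀ r : Fin N, Matrix (Fin (m r)) (Fin (m r)) ℂ
  lower : ∀ (r s : Fin N) (j : ℕ), s < r → j < α r → Matrix (Fin (m r)) (Fin (m s)) ℂ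
  skew : ∀ (r : Fin N) (j : ℕ), 1 ≤ j → j < α r → Matrix (Fin (m r)) (Fin (m r)) ℂ

/-- The admissible choices: `C_0^r = (A_0^{rr})ᵀ B_0^r A_0^{rr}`, the matrices `Z_j^r` are
skew-symmetric, and the blocks below the diagonal are arbitrary. -/
def Params.Admissible (P : Params α m) (B C : DiagCoeffs m) : Prop :=
  (∀ r, C r 0 = (P.diag r)ᵀ * B r 0 * P.diag r) ∧
  ∀ r j h₁ h₂, (P.skew r j h₁ h₂)ᵀ = -P.skew r j h₁ h₂

/-- All chosen matrices are real. -/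
def Params.IsReal (P : Params α m) : Prop :=
  (∀ r, IsRealMatrix (P.diag r)) ∧
  (∀ r s j h₁ h₂, IsRealMatrix (P.lower r s j h₁ h₂)) ∧
  ∀ r j h₁ h₂, IsRealMatrix (P.skew r j h₁ h₂)

/-- `Φ_n^{ks} = ∑_{l=0}^n B_{n-l}^k A_l^{ks}`. -/
def phi (B : DiagCoeffs m) (A : Coeffs m) (k s : Fin N) (n : ℕ) :
    Matrix (Fin (m k)) (Fin (m s)) ℂ :=
  ∑ l ∈ Finset.range (n + 1), B k (n - l) * A k s l

/-- `Ψ_n^{krs} = ∑_{j=0}^n (A_j^{kr})ᵀ Φ_{n-j}^{ks}` for `n ≥ 0`, and `0` for `n < 0`. -/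
def psi (B : DiagCoeffs m) (A : Coeffs m) (k r s : Fin N) :
    ℤ → Matrix (Fin (m r)) (Fin (m s)) ℂ
  | Int.ofNat n => ∑ j ∈ Finset.range (n + 1), (A k r j)ᵀ * phi B A k s (n - j)
  | Int.negSucc _ => 0

/-- `D_j^{rr}`, the part of the `(1, j+1)` entry of the `(r, r)` block of `𝓕 𝓧ᵀ 𝓕 𝓑 𝓧` that does
not involve `A_j^{rr}`. -/
def diagD (α : Fin N → ℕ) (B : DiagCoeffs m) (A : Coeffs m) (r : Fin N) (j : ℕ) :
    Matrix (Fin (m r)) (Fin (m r)) ℂ :=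
  ∑ l ∈ Finset.range j, (A r r 0)ᵀ * B r (j - l) * A r r l +
  ∑ l ∈ Finset.Ico 1 j, (A r r l)ᵀ * phi B A r r (j - l) +
  ∑ k ∈ Finset.Iio r, psi B A k r r ((j : ℤ) - α k + α r) +
  ∑ k ∈ Finset.Ioi r, psi B A k r r ((j : ℤ) - α r + α k)

/-- `D_j^{rs}` for `r < s`, the part of the `(1, j+1)` entry of the `(r, s)` block of
`𝓕 𝓧ᵀ 𝓕 𝓑 𝓧` that does not involve `A_j^{rs}`. -/
def upperD (α : Fin N → ℕ) (B : DiagCoeffs m) (A : Coeffs m) (r s : Fin N) (j : ℕ) :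
    Matrix (Fin (m r)) (Fin (m s)) ℂ :=
  ∑ l ∈ Finset.range j, (A r r 0)ᵀ * B r (j - l) * A r s l +
  ∑ l ∈ Finset.Icc 1 j, (A r r l)ᵀ * phi B A r s (j - l) +
  ∑ k ∈ Finset.Iio r, psi B A k r s ((j : ℤ) - α k + α r) +
  ∑ k ∈ Finset.Ioc r s, psi B A k r s (j : ℤ) +
  ∑ k ∈ Finset.Ioi s, psi B A k r s ((j : ℤ) - α s + α k)

/-- The formula for `A_j^{rr}`, `1 ≤ j < α_r`, with `Z = Z_j^r`. -/
noncomputable def diagFormula (α : Fin N → ℕ) (B C : DiagCoeffs m) (A : Coeffs m) (r : Fin N)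
    (j : ℕ) (Z : Matrix (Fin (m r)) (Fin (m r)) ℂ) : Matrix (Fin (m r)) (Fin (m r)) ℂ :=
  A r r 0 * (C r 0)⁻¹ * (Z + (1 / 2 : ℂ) • (C r j - diagD α B A r j))

/-- The formula for `A_j^{rs}`, `r < s`, `j < α_s`. -/
noncomputable def upperFormula (α : Fin N → ℕ) (B C : DiagCoeffs m) (A : Coeffs m)
    (r s : Fin N) (j : ℕ) : Matrix (Fin (m r)) (Fin (m s)) ℂ :=
  -(A r r 0 * (C r 0)⁻¹ * upperD α B A r s j)

/-- The state before the algorithm starts: the chosen `A_0^{rr}` and `A_j^{rs}`, `s < r`, are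
stored, everything else is (provisionally) zero. -/
def initState (P : Params α m) : Coeffs m := fun r =>
  Function.update
    (fun s n => if h : s < r ∧ n < α r then P.lower r s n h.1 h.2 else 0)
    r (fun n => if n = 0 then P.diag r else 0)

/-- Assign `A_j^{rr}` for all `r` with `1 ≤ j < α_r`. -/
noncomputable def diagStep (B C : DiagCoeffs m) (P : Params α m) (j : ℕ) (A : Coeffs m) :
    Coeffs m := fun r =>
  if h : 1 ≤ j ∧ j < α r then
    Function.update (A r) r
      (Function.update (A r r) j (diagFormula α B C A r j (P.skew r j h.1 h.2)))
  else A r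

/-- Assign `A_j^{r(r+p)}` for all `r` with `r + p ≤ N` and `j < α_{r+p}`. -/
noncomputable def upperStep (α : Fin N → ℕ) (B C : DiagCoeffs m) (j p : ℕ) (A : Coeffs m) :
    Coeffs m := fun r s n =>
  if s.val = r.val + p ∧ n = j ∧ j < α s then upperFormula α B C A r s j else A r s n

/-- The algorithm: for `j = 0, …, α_1 - 1` (`α_1` being the largest `α_r`), first assign all
`A_j^{rr}`, then for `p = 1, …, N - 1` all `A_j^{r(r+p)}`. -/
noncomputable def algorithm (B C : DiagCoeffs m) (P : Params α m) : Coeffs m :=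
  (List.range (Finset.univ.sup α)).foldl
    (fun A j => (List.range (N - 1)).foldl
      (fun A' q => upperStep α B C j (q + 1) A') (diagStep B C P j A))
    (initState P)

end

end ToeplitzEq

/-! Write X* for 𝓕 Xᵀ 𝓕. Block Toeplitz matrices of form (2) are closed under products, where
coefficients multiply by delayed Cauchy convolution, and under the anti-involution X ↦ X*
(`blockToeplitz_mul`, `flipT_blockToeplitz`). So 𝓒 = X* 𝓑 X is a system of equations between
coefficients. Since 𝓑* = 𝓑, the right side is fixed by *, and only the equations for r ≤ s matter
(`transpose_formC`).

Put S = (A_0^{rr})ᵀ B_0^r A_j^{rs}. For r < s the equation reads S + D_j^{rs} = 0, which is linear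
in A_j^{rs} with an invertible coefficient. For r = s and j ≥ 1 it reads S + Sᵀ = C_j^r - D_j^{rr}
with a symmetric right side, so S is half of it plus an arbitrary skew-symmetric Z_j^r. For r = s
and j = 0 it is the congruence for A_0^{rr} (`formC_upper`, `formC_diag`, `formC_diag_zero`). The
strict decrease of α ensures that each D involves only blocks known earlier (`diagD_congr`,
`upperD_congr`). Hence the formulas determine all blocks (`Follows.unique`), the algorithm produces
them (`follows_algorithm`), and choices correspond to solutions (`bijOn_algorithm`). Nonsingular
complex symmetric matrices are congruent, so a choice exists.

For the manifold structure fix a solution X₀ and write X = X₀ Y. The equation becomes Y* 𝓒 Y = 𝓒,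
and the Cayley transform K = (Y - 1)(Y + 1)⁻¹ makes it linear: 𝓒 K is Toeplitz with (𝓒 K)* = -𝓒 K
(`mem_solutions_iff_of_mem`). This gives a chart around X₀, and the dimension is a count of the free
entries of such skew matrices (`finrank_skewToeplitz`).

Conjugation commutes with the formulas, so by uniqueness a solution is real exactly when its data
are (`isRealMatrix_algorithm_iff`). Real A_0^{rr} exist exactly when the inertias agree, by
Sylvester's law (`exists_real_congruence_iff`). -/

namespace ToeplitzEq

open Matrix

/-! ### Products and flipped transposes of rectangular Toeplitz blocks -/

/-- The sequence `f` delayed by `u` steps. -/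
def shiftSeq {M : Type*} [Zero M] (u : ℕ) (f : ℕ → M) (n : ℕ) : M :=
  if u ≤ n then f (n - u) else 0

/-- The Cauchy product of two sequences of matrices. -/
def convSeq {p q t : Type*} [Fintype q] (f : ℕ → Matrix p q ℂ) (g : ℕ → Matrix q t ℂ) (n : ℕ) :
    Matrix p t ℂ :=
  ∑ i ∈ Finset.range (n + 1), f i * g (n - i)

@[simp] lemma shiftSeq_zero {M : Type*} [Zero M] (f : ℕ → M) : shiftSeq 0 f = f := by
  funext n; simp [shiftSeq]

/-- The zero columns of the two factors add up to `(b - a) + (c - b)`, while the normal form of an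
`a × c` block has only `c - a`. With truncated subtraction the surplus can be positive, and it
delays the convolution. -/
lemma rectToeplitz_mul {p q t : Type*} [Fintype q] (a b c : ℕ)
    (f : ℕ → Matrix p q ℂ) (g : ℕ → Matrix q t ℂ) :
    rectToeplitz a b f * rectToeplitz b c g =
      rectToeplitz a c (shiftSeq ((b - a) + (c - b) - (c - a)) (convSeq f g)) := by
  ext ⟨i, x⟩ ⟨j, y⟩
  rw [Matrix.mul_apply, Fintype.sum_prod_type]
  set u := b - a with hu
  set v := c - b with hv
  -- The summand is extended to all of ℕ; the bound `k < b` is implied by the two inequalities and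
  -- `j < c`.
  let F : ℕ → ℂ := fun k =>
    if i.val + u ≤ k ∧ k + v ≤ j.val then (f (k - (i.val + u)) * g (j.val - (k + v))) x y else 0
  have h1 : ∀ k : Fin b, (∑ z : q, rectToeplitz a b f (i, x) (k, z) *
      rectToeplitz b c g (k, z) (j, y)) = F k.val := by
    intro k
    simp only [rectToeplitz, F, ← hu, ← hv]
    by_cases h₁ : i.val + u ≤ k.val <;> by_cases h₂ : k.val + v ≤ j.val <;>
      simp [h₁, h₂, Matrix.mul_apply]
  rw [Finset.sum_congr rfl fun k _ => h1 k, Fin.sum_univ_eq_sum_range]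
  have hi := i.isLt
  have hj := j.isLt
  by_cases h : i.val + u + v ≤ j.val
  · have h₂ : i.val + (c - a) ≤ j.val := by omega
    have h₃ : u + v - (c - a) ≤ j.val - (i.val + (c - a)) := by omega
    have h₄ : j.val - (i.val + (c - a)) - (u + v - (c - a)) = j.val - (i.val + u + v) := by omega
    simp only [rectToeplitz, h₂, if_true, shiftSeq, h₃, h₄, convSeq, Matrix.sum_apply]
    symm
    refine Finset.sum_of_injOn (fun l => l + i.val + u) ?_ ?_ ?_ ?_
    · intro l _ l' _ hl; simp only at hl; omega
    · intro l hl
      simp only [Finset.coe_range, Set.mem_Iio] at hl ⊢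
      omega
    · intro k hk hk'
      simp only [F]
      rw [if_neg]
      rintro ⟨h5, h6⟩
      refine hk' ⟨k - i.val - u, ?_, ?_⟩
      · simp only [Finset.coe_range, Set.mem_Iio]; omega
      · simp only; omega
    · intro l hl
      simp only [Finset.mem_range] at hl
      simp only [F]
      rw [if_pos (by omega)]
      have e₁ : l + i.val + u - (i.val + u) = l := by omega
      have e₂ : j.val - (l + i.val + u + v) = j.val - (i.val + u + v) - l := by omega
      rw [e₁, e₂]
  · have hR : rectToeplitz a c (shiftSeq (u + v - (c - a)) (convSeq f g)) (i, x) (j, y) = 0 := by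
      simp only [rectToeplitz, shiftSeq]
      split_ifs with h5 h6
      · exfalso; omega
      · rfl
      · rfl
    rw [hR]
    refine Finset.sum_eq_zero fun k _ => ?_
    simp only [F]
    rw [if_neg (by omega)]

/-- Transposing and then reversing the order of block rows and block columns is reflection in the
anti-diagonal. It maps every block diagonal to itself, so only the blocks themselves get transposed.
-/
lemma antiDiag_mul_transpose_rectToeplitz_mul (a b p q : ℕ)
    (f : ℕ → Matrix (Fin p) (Fin q) ℂ) :
    antiDiag b q * (rectToeplitz a b f)ᵀ * antiDiag a p = rectToeplitz b a fun j => (f j)ᵀ := by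
  ext ⟨i, x⟩ ⟨j, y⟩
  have h1 : ∀ z : Fin a × Fin p, (antiDiag b q * (rectToeplitz a b f)ᵀ) (i, x) z =
      rectToeplitz a b f z (Fin.rev i, x) := by
    intro z
    rw [Matrix.mul_apply, Finset.sum_eq_single (Fin.rev i, x)]
    · simp [antiDiag]
    · rintro ⟨k, w⟩ - hne
      have : ¬ (k = Fin.rev i ∧ x = w) := by
        rintro ⟨rfl, rfl⟩; exact hne rfl
      simp [antiDiag, this]
    · simp
  rw [Matrix.mul_apply, Finset.sum_eq_single (Fin.rev j, y)]
  · rw [h1]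
    have hi := i.isLt
    have hj := j.isLt
    have e : (Fin.rev j).val + (b - a) ≤ (Fin.rev i).val ↔ i.val + (a - b) ≤ j.val := by
      simp only [Fin.val_rev]; omega
    simp only [antiDiag, Fin.rev_rev, and_self, if_true, mul_one, rectToeplitz, e]
    split_ifs with h
    · simp only [Matrix.transpose_apply]
      have e' : (Fin.rev i).val - ((Fin.rev j).val + (b - a)) = j.val - (i.val + (a - b)) := by
        simp only [Fin.val_rev]; omega
      rw [e']
    · rfl
  · rintro ⟨k, w⟩ - hne
    have : ¬ (j = Fin.rev k ∧ w = y) := by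
      rintro ⟨rfl, rfl⟩; simp at hne
    simp [antiDiag, this]
  · simp

/-! ### The calculus of block Toeplitz matrices -/

section

variable {N : ℕ} {α m : Fin N → ℕ}

/-- The coefficients of the block diagonal matrix with coefficients `B` on the diagonal. -/
def diagC (B : DiagCoeffs m) : Coeffs m := fun r => Function.update (fun _ => 0) r (B r)

@[simp] lemma diagC_same (B : DiagCoeffs m) (r : Fin N) : diagC B r r = B r := by
  simp [diagC]

lemma diagC_ne (B : DiagCoeffs m) {r s : Fin N} (h : r ≠ s) (n : ℕ) : diagC B r s n = 0 := by
  simp [diagC, Function.update_of_ne h.symm]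

/-- The coefficients of the flipped transpose. -/
def flipC (A : Coeffs m) : Coeffs m := fun r s n => (A s r n)ᵀ

/-- The coefficients of a product. -/
def mulC (α : Fin N → ℕ) (A A' : Coeffs m) : Coeffs m := fun r s n =>
  ∑ k, shiftSeq ((α k - α r) + (α s - α k) - (α s - α r)) (convSeq (A r k) (A' k s)) n

lemma rectToeplitz_sum {p q ι : Type*} (a b : ℕ) (s : Finset ι) (f : ι → ℕ → Matrix p q ℂ)
    (x : Fin a × p) (y : Fin b × q) :
    rectToeplitz a b (fun n => ∑ i ∈ s, f i n) x y = ∑ i ∈ s, rectToeplitz a b (f i) x y := by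
  simp only [rectToeplitz]
  split_ifs
  · simp [Matrix.sum_apply]
  · simp

lemma blockToeplitz_mul (A A' : Coeffs m) :
    blockToeplitz α A * blockToeplitz α A' = blockToeplitz α (mulC α A A') := by
  ext ⟨r, x⟩ ⟨s, y⟩
  rw [Matrix.mul_apply, Fintype.sum_sigma]
  have h : ∀ k : Fin N, (∑ z : Fin (α k) × Fin (m k), blockToeplitz α A ⟨r, x⟩ ⟨k, z⟩ *
      blockToeplitz α A' ⟨k, z⟩ ⟨s, y⟩) =
      rectToeplitz (α r) (α s) (shiftSeq ((α k - α r) + (α s - α k) - (α s - α r))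
        (convSeq (A r k) (A' k s))) x y := by
    intro k
    rw [← rectToeplitz_mul]
    rfl
  rw [Finset.sum_congr rfl fun k _ => h k, ← rectToeplitz_sum]
  rfl

lemma diagToeplitz_eq (B : DiagCoeffs m) : diagToeplitz α B = blockToeplitz α (diagC B) := by
  ext ⟨r, x⟩ ⟨s, y⟩
  by_cases h : r = s
  · subst h
    simp [diagToeplitz, blockToeplitz]
  · rw [diagToeplitz, Matrix.blockDiagonal'_apply_ne _ _ _ h]
    simp [blockToeplitz, rectToeplitz, diagC_ne B h]

/-- The flipped transpose `𝓕 Xᵀ 𝓕`. -/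
def flipT (X : Matrix (Idx α m) (Idx α m) ℂ) : Matrix (Idx α m) (Idx α m) ℂ :=
  flipMatrix α m * Xᵀ * flipMatrix α m

lemma antiDiag_mul_self (a n : ℕ) : antiDiag a n * antiDiag a n = 1 := by
  ext ⟨i, x⟩ ⟨j, y⟩
  rw [Matrix.mul_apply, Finset.sum_eq_single (Fin.rev i, x)]
  · simp only [antiDiag, Fin.rev_rev, and_self, if_true, one_mul, Matrix.one_apply, Prod.mk.injEq]
    congr 1
    simp [eq_comm]
  · rintro ⟨k, w⟩ - hne
    have : ¬ (k = Fin.rev i ∧ x = w) := by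
      rintro ⟨rfl, rfl⟩; exact hne rfl
    simp [antiDiag, this]
  · simp

lemma transpose_antiDiag (a n : ℕ) : (antiDiag a n)ᵀ = antiDiag a n := by
  ext ⟨i, x⟩ ⟨j, y⟩
  simp only [Matrix.transpose_apply, antiDiag]
  congr 1
  rw [eq_iff_iff, ← Fin.rev_eq_iff]
  tauto

lemma flipMatrix_mul_self : flipMatrix α m * flipMatrix α m = 1 := by
  rw [flipMatrix, ← Matrix.blockDiagonal'_mul]
  simp only [antiDiag_mul_self]
  exact Matrix.blockDiagonal'_one

lemma transpose_flipMatrix : (flipMatrix α m)ᵀ = flipMatrix α m := by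
  rw [flipMatrix, Matrix.blockDiagonal'_transpose]
  simp only [transpose_antiDiag]

lemma flipT_mul (X Y : Matrix (Idx α m) (Idx α m) ℂ) : flipT (X * Y) = flipT Y * flipT X := by
  simp only [flipT, Matrix.transpose_mul]
  calc _ = flipMatrix α m * Yᵀ * 1 * Xᵀ * flipMatrix α m := by simp only [mul_one, mul_assoc]
    _ = _ := by rw [← flipMatrix_mul_self]; simp only [mul_assoc]

lemma flipT_flipT (X : Matrix (Idx α m) (Idx α m) ℂ) : flipT (flipT X) = X := by
  simp only [flipT, Matrix.transpose_mul, transpose_flipMatrix, Matrix.transpose_transpose]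
  calc _ = (flipMatrix α m * flipMatrix α m) * X * (flipMatrix α m * flipMatrix α m) := by
        simp only [mul_assoc]
    _ = X := by rw [flipMatrix_mul_self, one_mul, mul_one]

lemma flipT_one : flipT (1 : Matrix (Idx α m) (Idx α m) ℂ) = 1 := by
  simp [flipT, flipMatrix_mul_self]

lemma flipT_add (X Y : Matrix (Idx α m) (Idx α m) ℂ) : flipT (X + Y) = flipT X + flipT Y := by
  simp [flipT, mul_add, add_mul]

lemma flipT_neg (X : Matrix (Idx α m) (Idx α m) ℂ) : flipT (-X) = -flipT X := by
  simp [flipT]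

lemma flipT_sub (X Y : Matrix (Idx α m) (Idx α m) ℂ) : flipT (X - Y) = flipT X - flipT Y := by
  rw [sub_eq_add_neg, flipT_add, flipT_neg, sub_eq_add_neg]

lemma flipMatrix_mul_apply (X : Matrix (Idx α m) (Idx α m) ℂ) (r s : Fin N)
    (x : Fin (α r) × Fin (m r)) (y : Fin (α s) × Fin (m s)) :
    (flipMatrix α m * X) ⟨r, x⟩ ⟨s, y⟩ =
      (antiDiag (α r) (m r) * Matrix.of (fun x y => X ⟨r, x⟩ ⟨s, y⟩)) x y := by
  rw [Matrix.mul_apply, Fintype.sum_sigma, Finset.sum_eq_single r, Matrix.mul_apply]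
  · simp [flipMatrix]
  · intro k _ hk
    refine Finset.sum_eq_zero fun z _ => ?_
    rw [flipMatrix, Matrix.blockDiagonal'_apply_ne _ _ _ hk.symm, zero_mul]
  · simp

lemma mul_flipMatrix_apply (X : Matrix (Idx α m) (Idx α m) ℂ) (r s : Fin N)
    (x : Fin (α r) × Fin (m r)) (y : Fin (α s) × Fin (m s)) :
    (X * flipMatrix α m) ⟨r, x⟩ ⟨s, y⟩ =
      (Matrix.of (fun x y => X ⟨r, x⟩ ⟨s, y⟩) * antiDiag (α s) (m s)) x y := by
  rw [Matrix.mul_apply, Fintype.sum_sigma, Finset.sum_eq_single s, Matrix.mul_apply]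
  · simp [flipMatrix]
  · intro k _ hk
    refine Finset.sum_eq_zero fun z _ => ?_
    rw [flipMatrix, Matrix.blockDiagonal'_apply_ne _ _ _ hk, mul_zero]
  · simp

lemma flipT_blockToeplitz (A : Coeffs m) :
    flipT (blockToeplitz α A) = blockToeplitz α (flipC A) := by
  ext ⟨r, x⟩ ⟨s, y⟩
  rw [flipT, mul_flipMatrix_apply]
  have h : Matrix.of (fun x y => (flipMatrix α m * (blockToeplitz α A)ᵀ) ⟨r, x⟩ ⟨s, y⟩) =
      antiDiag (α r) (m r) * (rectToeplitz (α s) (α r) (A s r))ᵀ := by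
    ext x y
    exact flipMatrix_mul_apply _ r s x y
  rw [h, antiDiag_mul_transpose_rectToeplitz_mul]
  rfl

lemma blockToeplitz_inj {A A' : Coeffs m} :
    blockToeplitz α A = blockToeplitz α A' ↔
      ∀ r s n, n < α r → n < α s → A r s n = A' r s n := by
  constructor
  · intro h r s n hr hs
    ext i k
    -- The first block row lists the coefficients in order, after `α s - α r` zero columns.
    have h1 : (α s - α r) + n < α s := by omega
    have := congrFun (congrFun h ⟨r, ⟨0, by omega⟩, i⟩) ⟨s, ⟨(α s - α r) + n, h1⟩, k⟩
    simpa [blockToeplitz, rectToeplitz] using this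
  · intro h
    ext ⟨r, i, x⟩ ⟨s, j, y⟩
    simp only [blockToeplitz, rectToeplitz]
    split_ifs with hij
    · have := i.isLt
      have := j.isLt
      rw [h r s _ (by omega) (by omega)]
    · rfl

lemma flipT_diagToeplitz {B : DiagCoeffs m} (hB : ∀ r, ∀ j < α r, (B r j).IsSymm) :
    flipT (diagToeplitz α B) = diagToeplitz α B := by
  rw [diagToeplitz_eq, flipT_blockToeplitz, blockToeplitz_inj]
  intro r s n hr _
  by_cases h : r = s
  · subst h; simpa [flipC] using (hB r n hr).eq
  · rw [flipC, diagC_ne B h, diagC_ne B (Ne.symm h), Matrix.transpose_zero]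

end

/-! ### The equation in terms of coefficients -/

section

variable {N : ℕ} {α m : Fin N → ℕ}

lemma sum_univ_eq_Iio_add_Ioi {M : Type*} [AddCommMonoid M] (f : Fin N → M) (r : Fin N) :
    ∑ k, f k = f r + ∑ k ∈ Finset.Iio r, f k + ∑ k ∈ Finset.Ioi r, f k := by
  have h₁ : Finset.Iio r = Finset.univ.filter (· < r) := by ext; simp
  have h₂ : Finset.Ioi r = Finset.univ.filter (r < ·) := by ext; simp
  have h₃ : f r = ∑ k, if k = r then f k else 0 := by simp
  rw [h₁, h₂, h₃, Finset.sum_filter, Finset.sum_filter, ← Finset.sum_add_distrib,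
    ← Finset.sum_add_distrib]
  refine Finset.sum_congr rfl fun k _ => ?_
  rcases lt_trichotomy k r with h | h | h
  · simp [h, h.ne, h.not_gt]
  · simp [h]
  · simp [h, h.ne', h.not_gt]

/-- The delay of the k-th summand of a product has a different form on each of these ranges of k. -/
lemma sum_univ_eq_Iio_add_Ioc_add_Ioi {M : Type*} [AddCommMonoid M] (f : Fin N → M)
    {r s : Fin N} (hrs : r ≤ s) :
    ∑ k, f k = f r + ∑ k ∈ Finset.Iio r, f k + ∑ k ∈ Finset.Ioc r s, f k +
      ∑ k ∈ Finset.Ioi s, f k := by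
  have h : Finset.Ioi r = Finset.Ioc r s ∪ Finset.Ioi s := by
    ext k
    simp only [Finset.mem_Ioi, Finset.mem_union, Finset.mem_Ioc]
    constructor
    · intro h; rcases le_or_gt k s with h' | h'
      · exact Or.inl ⟨h, h'⟩
      · exact Or.inr h'
    · rintro (h | h)
      · exact h.1
      · exact hrs.trans_lt h
  have hd : Disjoint (Finset.Ioc r s) (Finset.Ioi s) := by
    rw [Finset.disjoint_left]
    intro k hk hk'
    exact absurd (Finset.mem_Ioc.1 hk).2 (not_le.2 (Finset.mem_Ioi.1 hk'))
  rw [sum_univ_eq_Iio_add_Ioi f r, h, Finset.sum_union hd]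
  abel

/-- `Ψ^{krs}` as a sequence indexed by `ℕ`. -/
def psiSeq (B : DiagCoeffs m) (A : Coeffs m) (k r s : Fin N) (n : ℕ) :
    Matrix (Fin (m r)) (Fin (m s)) ℂ :=
  convSeq (fun i => (A k r i)ᵀ) (phi B A k s) n

lemma psi_eq_shiftSeq (B : DiagCoeffs m) (A : Coeffs m) (k r s : Fin N) {z : ℤ} {n u : ℕ}
    (h : z = (n : ℤ) - u) : psi B A k r s z = shiftSeq u (psiSeq B A k r s) n := by
  rcases le_or_gt u n with hu | hu
  · have : z = Int.ofNat (n - u) := by simp only [Int.ofNat_eq_natCast]; omega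
    rw [this, shiftSeq, if_pos hu]
    rfl
  · obtain ⟨t, rfl⟩ : ∃ t, u = n + (t + 1) := ⟨u - n - 1, by omega⟩
    have : z = Int.negSucc t := by rw [Int.negSucc_eq]; push_cast at h; omega
    rw [this, shiftSeq, if_neg (by omega)]
    rfl

lemma mulC_diagC (B : DiagCoeffs m) (A : Coeffs m) : mulC α (diagC B) A = phi B A := by
  funext k s n
  rw [mulC, Finset.sum_eq_single k]
  · simp only [diagC_same, Nat.sub_self, zero_add, shiftSeq_zero, convSeq, phi]
    -- `convSeq` sums over the index of the left factor, `phi` over that of the right one.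
    rw [← Finset.sum_range_reflect]
    refine Finset.sum_congr rfl fun l hl => ?_
    have := Finset.mem_range.1 hl
    congr 2
    all_goals omega
  · intro t _ ht
    simp [shiftSeq, convSeq, diagC_ne B ht.symm]
  · simp

/-- The coefficients of `𝓕 𝓧ᵀ 𝓕 𝓑 𝓧`. -/
def formC (α : Fin N → ℕ) (B : DiagCoeffs m) (A : Coeffs m) : Coeffs m := fun r s n =>
  ∑ k, shiftSeq ((α k - α r) + (α s - α k) - (α s - α r)) (psiSeq B A k r s) n

lemma mulC_flipC_phi (B : DiagCoeffs m) (A : Coeffs m) :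
    mulC α (flipC A) (phi B A) = formC α B A := rfl

lemma flipT_mul_diagToeplitz_mul (B : DiagCoeffs m) (A : Coeffs m) :
    flipT (blockToeplitz α A) * (diagToeplitz α B * blockToeplitz α A) =
      blockToeplitz α (formC α B A) := by
  rw [flipT_blockToeplitz, diagToeplitz_eq, blockToeplitz_mul, mulC_diagC, blockToeplitz_mul,
    mulC_flipC_phi]

lemma flipMatrix_mul_eq (B : DiagCoeffs m) (X : Matrix (Idx α m) (Idx α m) ℂ) :
    flipMatrix α m * Xᵀ * flipMatrix α m * diagToeplitz α B * X =
      flipT X * (diagToeplitz α B * X) := by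
  rw [flipT, Matrix.mul_assoc _ (diagToeplitz α B) X]

lemma mem_solutions_iff (B C : DiagCoeffs m) (X : Matrix (Idx α m) (Idx α m) ℂ) :
    X ∈ solutions α B C ↔ (∃ A : Coeffs m, X = blockToeplitz α A) ∧
      diagToeplitz α C = flipT X * (diagToeplitz α B * X) := by
  rw [← flipMatrix_mul_eq]; rfl

lemma blockToeplitz_mem_solutions_iff (B C : DiagCoeffs m) (A : Coeffs m) :
    blockToeplitz α A ∈ solutions α B C ↔
      ∀ r s n, n < α r → n < α s → diagC C r s n = formC α B A r s n := by
  rw [mem_solutions_iff, flipT_mul_diagToeplitz_mul, diagToeplitz_eq, blockToeplitz_inj]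
  exact and_iff_right ⟨A, rfl⟩

/-- Since 𝓑* = 𝓑, also (X* 𝓑 X)* = X* 𝓑 X. Thus the equations below the block diagonal follow from
those above it. -/
lemma transpose_formC {B : DiagCoeffs m} (hB : ∀ r, ∀ j < α r, (B r j).IsSymm) (A : Coeffs m)
    {r s : Fin N} {n : ℕ} (hr : n < α r) (hs : n < α s) :
    (formC α B A s r n)ᵀ = formC α B A r s n := by
  have h : flipT (blockToeplitz α (formC α B A)) = blockToeplitz α (formC α B A) := by
    rw [← flipT_mul_diagToeplitz_mul, flipT_mul, flipT_mul, flipT_flipT, flipT_diagToeplitz hB,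
      mul_assoc]
  rw [flipT_blockToeplitz, blockToeplitz_inj] at h
  exact h r s n hr hs

lemma psiSeq_zero (B : DiagCoeffs m) (A : Coeffs m) (k r s : Fin N) :
    psiSeq B A k r s 0 = (A k r 0)ᵀ * B k 0 * A k s 0 := by
  simp [psiSeq, convSeq, phi, Matrix.mul_assoc]

/-- Isolates the summand in which `A r s j` is multiplied by `B r 0`. For `r = s` the block occurs
once more, in the last term of the second sum. -/
lemma psiSeq_eq_add (B : DiagCoeffs m) (A : Coeffs m) (r s : Fin N) (j : ℕ) :
    psiSeq B A r r s j = (A r r 0)ᵀ * B r 0 * A r s j +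
      (∑ l ∈ Finset.range j, (A r r 0)ᵀ * B r (j - l) * A r s l +
        ∑ l ∈ Finset.Icc 1 j, (A r r l)ᵀ * phi B A r s (j - l)) := by
  rw [psiSeq, convSeq, Finset.range_eq_Ico, Finset.sum_eq_sum_Ico_succ_bot (by omega),
    zero_add, Nat.sub_zero]
  have h₁ : (A r r 0)ᵀ * phi B A r s j = (A r r 0)ᵀ * B r 0 * A r s j +
      ∑ l ∈ Finset.range j, (A r r 0)ᵀ * B r (j - l) * A r s l := by
    rw [phi, Finset.sum_range_succ, Matrix.mul_add, Matrix.mul_sum, Nat.sub_self, add_comm]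
    simp only [Matrix.mul_assoc]
  have h₂ : Finset.Ico 1 (j + 1) = Finset.Icc 1 j := rfl
  rw [h₁, h₂, add_assoc]

/-- For `k ≠ r` the delay is |α k - α r|, which is positive because α is injective, so only `k = r`
contributes at index 0. -/
lemma formC_diag_zero (hα : StrictAnti α) (B : DiagCoeffs m) (A : Coeffs m) (r : Fin N) :
    formC α B A r r 0 = (A r r 0)ᵀ * B r 0 * A r r 0 := by
  rw [formC, Finset.sum_eq_single r]
  · simp [psiSeq_zero]
  · intro k _ hk
    have := hα.injective.ne hk
    rw [shiftSeq, if_neg (by omega)]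
  · simp

lemma formC_diag (hα : StrictAnti α) (B : DiagCoeffs m) (A : Coeffs m) (r : Fin N) {j : ℕ}
    (hj : 1 ≤ j) :
    formC α B A r r j = (A r r 0)ᵀ * B r 0 * A r r j + (A r r j)ᵀ * B r 0 * A r r 0 +
      diagD α B A r j := by
  rw [formC, sum_univ_eq_Iio_add_Ioi _ r, diagD]
  have h₁ : ∀ k ∈ Finset.Iio r, psi B A k r r ((j : ℤ) - α k + α r) =
      shiftSeq ((α k - α r) + (α r - α k) - (α r - α r)) (psiSeq B A k r r) j := by
    intro k hk
    have := hα (Finset.mem_Iio.1 hk)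
    exact psi_eq_shiftSeq _ _ _ _ _ (by omega)
  have h₃ : ∀ k ∈ Finset.Ioi r, psi B A k r r ((j : ℤ) - α r + α k) =
      shiftSeq ((α k - α r) + (α r - α k) - (α r - α r)) (psiSeq B A k r r) j := by
    intro k hk
    have := hα (Finset.mem_Ioi.1 hk)
    exact psi_eq_shiftSeq _ _ _ _ _ (by omega)
  have h₂ : ∑ l ∈ Finset.Icc 1 j, (A r r l)ᵀ * phi B A r r (j - l) =
      ∑ l ∈ Finset.Ico 1 j, (A r r l)ᵀ * phi B A r r (j - l) + (A r r j)ᵀ * B r 0 * A r r 0 := by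
    rw [← Finset.sum_Ico_add_eq_sum_Icc hj, Nat.sub_self]
    simp [phi, Matrix.mul_assoc]
  rw [Finset.sum_congr rfl h₁, Finset.sum_congr rfl h₃, Nat.sub_self, Nat.add_zero,
    Nat.sub_self, shiftSeq_zero, psiSeq_eq_add, h₂]
  abel

/-- As `α s < α r`, the delay is `α k - α r` for `k < r`, zero for `r ≤ k ≤ s`, and `α s - α k` for
`k > s`. These are the index shifts in `upperD`. -/
lemma formC_upper (hα : StrictAnti α) (B : DiagCoeffs m) (A : Coeffs m) {r s : Fin N}
    (hrs : r < s) (j : ℕ) :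
    formC α B A r s j = (A r r 0)ᵀ * B r 0 * A r s j + upperD α B A r s j := by
  have hα' := hα hrs
  rw [formC, sum_univ_eq_Iio_add_Ioc_add_Ioi _ hrs.le, upperD]
  have h₁ : ∀ k ∈ Finset.Iio r, psi B A k r s ((j : ℤ) - α k + α r) =
      shiftSeq ((α k - α r) + (α s - α k) - (α s - α r)) (psiSeq B A k r s) j := by
    intro k hk
    have := hα (Finset.mem_Iio.1 hk)
    exact psi_eq_shiftSeq _ _ _ _ _ (by omega)
  have h₂ : ∀ k ∈ Finset.Ioc r s, psi B A k r s (j : ℤ) =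
      shiftSeq ((α k - α r) + (α s - α k) - (α s - α r)) (psiSeq B A k r s) j := by
    intro k hk
    have := hα (Finset.mem_Ioc.1 hk).1
    have := hα.antitone (Finset.mem_Ioc.1 hk).2
    exact psi_eq_shiftSeq _ _ _ _ _ (by omega)
  have h₃ : ∀ k ∈ Finset.Ioi s, psi B A k r s ((j : ℤ) - α s + α k) =
      shiftSeq ((α k - α r) + (α s - α k) - (α s - α r)) (psiSeq B A k r s) j := by
    intro k hk
    have := hα (Finset.mem_Ioi.1 hk)
    exact psi_eq_shiftSeq _ _ _ _ _ (by omega)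
  rw [Finset.sum_congr rfl h₁, Finset.sum_congr rfl h₂, Finset.sum_congr rfl h₃, Nat.sub_self,
    zero_add, Nat.sub_self, shiftSeq_zero, psiSeq_eq_add]
  abel

end

/-! ### The recursion and the algorithm -/

section

variable {N : ℕ} {α m : Fin N → ℕ}

/-- `A` and `A'` agree on the blocks that are known before the algorithm assigns the blocks
`A_j^{r(r+p)}`. -/
def AgreeBefore (α : Fin N → ℕ) (j p : ℕ) (A A' : Coeffs m) : Prop :=
  ∀ r s n, n < α r → n < α s → (s < r ∨ n < j ∨ (n = j ∧ s.val < r.val + p)) →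
    A r s n = A' r s n

lemma phi_congr {B B' : DiagCoeffs m} {A A' : Coeffs m} {k s : Fin N} {n : ℕ}
    (hB : ∀ l ≤ n, B k l = B' k l) (hA : ∀ l ≤ n, A k s l = A' k s l) :
    phi B A k s n = phi B' A' k s n := by
  refine Finset.sum_congr rfl fun l hl => ?_
  have := Finset.mem_range.1 hl
  rw [hB _ (by omega), hA _ (by omega)]

lemma psi_congr {B B' : DiagCoeffs m} {A A' : Coeffs m} {k r s : Fin N} {z : ℤ}
    (hB : ∀ l : ℕ, (l : ℤ) ≤ z → B k l = B' k l)
    (hr : ∀ l : ℕ, (l : ℤ) ≤ z → A k r l = A' k r l)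
    (hs : ∀ l : ℕ, (l : ℤ) ≤ z → A k s l = A' k s l) :
    psi B A k r s z = psi B' A' k r s z := by
  cases z with
  | ofNat n =>
    refine Finset.sum_congr rfl fun l hl => ?_
    have := Finset.mem_range.1 hl
    simp only [Int.ofNat_eq_natCast, Nat.cast_le] at hB hr hs
    rw [hr _ (by omega), phi_congr (fun i hi => hB i (by omega)) (fun i hi => hs i (by omega))]
  | negSucc n => rfl

/-- All blocks read are already known: for `k < r` the delay is positive, so their index is below j;
for `k > r` they lie below the diagonal; for `k = r` their index is below j. The data `B` and `B'`
may differ in blocks that do not occur, which allows a later comparison with conjugated data. -/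
lemma diagD_congr (hα : StrictAnti α) {B B' : DiagCoeffs m} {A A' : Coeffs m}
    (hB : ∀ r, ∀ l < α r, B r l = B' r l) {r : Fin N} {j : ℕ} (hj : 1 ≤ j) (hjr : j < α r)
    (hA : AgreeBefore α j 0 A A') : diagD α B A r j = diagD α B' A' r j := by
  unfold diagD
  congr 1
  · congr 1
    · congr 1
      · refine Finset.sum_congr rfl fun l hl => ?_
        have := Finset.mem_range.1 hl
        rw [hA r r 0 (by omega) (by omega) (by omega), hB r _ (by omega),
          hA r r l (by omega) (by omega) (by omega)]
      · refine Finset.sum_congr rfl fun l hl => ?_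
        have := Finset.mem_Ico.1 hl
        rw [hA r r l (by omega) (by omega) (by omega),
          phi_congr (fun i hi => hB r i (by omega))
            (fun i hi => hA r r i (by omega) (by omega) (by omega))]
    · refine Finset.sum_congr rfl fun k hk => ?_
      have := hα (Finset.mem_Iio.1 hk)
      exact psi_congr (fun i hi => hB k i (by omega))
        (fun i hi => hA k r i (by omega) (by omega) (by omega))
        (fun i hi => hA k r i (by omega) (by omega) (by omega))
  · refine Finset.sum_congr rfl fun k hk => ?_
    have hk' := Finset.mem_Ioi.1 hk
    have := hα hk'
    exact psi_congr (fun i hi => hB k i (by omega))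
      (fun i hi => hA k r i (by omega) (by omega) (Or.inl hk'))
      (fun i hi => hA k r i (by omega) (by omega) (Or.inl hk'))

/-- For `r < k ≤ s` the block `A k s` may be read at index j itself, but it is closer to the
diagonal than `A r s`, hence assigned earlier in the round. The block `A r r j` comes from the
diagonal step. All other blocks have smaller index or lie below the diagonal. -/
lemma upperD_congr (hα : StrictAnti α) {B B' : DiagCoeffs m} {A A' : Coeffs m}
    (hB : ∀ r, ∀ l < α r, B r l = B' r l) {r s : Fin N} {j p : ℕ} (hp : s.val = r.val + p)
    (hp₀ : 0 < p) (hjs : j < α s)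
    (hA : AgreeBefore α j p A A') : upperD α B A r s j = upperD α B' A' r s j := by
  have hrs : r < s := by rw [Fin.lt_def]; omega
  have hα' := hα hrs
  unfold upperD
  congr 1
  · congr 1
    · congr 1
      · congr 1
        · refine Finset.sum_congr rfl fun l hl => ?_
          have := Finset.mem_range.1 hl
          rw [hA r r 0 (by omega) (by omega) (by omega), hB r _ (by omega),
            hA r s l (by omega) (by omega) (by omega)]
        · refine Finset.sum_congr rfl fun l hl => ?_
          have := Finset.mem_Icc.1 hl
          rw [hA r r l (by omega) (by omega) (by omega),
            phi_congr (fun i hi => hB r i (by omega))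
              (fun i hi => hA r s i (by omega) (by omega) (by omega))]
      · refine Finset.sum_congr rfl fun k hk => ?_
        have := hα (Finset.mem_Iio.1 hk)
        exact psi_congr (fun i hi => hB k i (by omega))
          (fun i hi => hA k r i (by omega) (by omega) (by omega))
          (fun i hi => hA k s i (by omega) (by omega) (by omega))
    · refine Finset.sum_congr rfl fun k hk => ?_
      have hk' := Finset.mem_Ioc.1 hk
      have := hα hk'.1
      have := hα.antitone hk'.2
      have := Fin.lt_def.1 hk'.1
      exact psi_congr (fun i hi => hB k i (by omega))
        (fun i hi => hA k r i (by omega) (by omega) (Or.inl hk'.1))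
        (fun i hi => hA k s i (by omega) (by omega) (by omega))
  · refine Finset.sum_congr rfl fun k hk => ?_
    have hk' := Finset.mem_Ioi.1 hk
    have := hα hk'
    exact psi_congr (fun i hi => hB k i (by omega))
      (fun i hi => hA k r i (by omega) (by omega) (Or.inl (hrs.trans hk')))
      (fun i hi => hA k s i (by omega) (by omega) (Or.inl hk'))

lemma diagFormula_congr (hα : StrictAnti α) {B B' C C' : DiagCoeffs m} {A A' : Coeffs m}
    (hB : ∀ r, ∀ l < α r, B r l = B' r l) (hC : ∀ r, ∀ l < α r, C r l = C' r l)
    {r : Fin N} {j : ℕ} (hj : 1 ≤ j) (hjr : j < α r)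
    (hA : AgreeBefore α j 0 A A') (Z : Matrix (Fin (m r)) (Fin (m r)) ℂ) :
    diagFormula α B C A r j Z = diagFormula α B' C' A' r j Z := by
  rw [diagFormula, diagFormula, diagD_congr hα hB hj hjr hA, hC r 0 (by omega), hC r j hjr,
    hA r r 0 (by omega) (by omega) (by omega)]

lemma upperFormula_congr (hα : StrictAnti α) {B B' C C' : DiagCoeffs m} {A A' : Coeffs m}
    (hB : ∀ r, ∀ l < α r, B r l = B' r l) (hC : ∀ r, ∀ l < α r, C r l = C' r l)
    {r s : Fin N} {j p : ℕ} (hp : s.val = r.val + p) (hp₀ : 0 < p) (hjs : j < α s)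
    (hA : AgreeBefore α j p A A') :
    upperFormula α B C A r s j = upperFormula α B' C' A' r s j := by
  have hrs : r < s := by rw [Fin.lt_def]; omega
  have hα' := hα hrs
  rw [upperFormula, upperFormula, upperD_congr hα hB hp hp₀ hjs hA, hC r 0 (by omega),
    hA r r 0 (by omega) (by omega) (by omega)]

/-- `A` keeps the chosen blocks `P`, and its other blocks satisfy the formulas of the
algorithm. -/
structure Follows (B C : DiagCoeffs m) (P : Params α m) (A : Coeffs m) : Prop where
  diag_zero : ∀ r, A r r 0 = P.diag r
  lower : ∀ r s j (h₁ : s < r) (h₂ : j < α r), A r s j = P.lower r s j h₁ h₂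
  diag : ∀ r j (h₁ : 1 ≤ j) (h₂ : j < α r),
    A r r j = diagFormula α B C A r j (P.skew r j h₁ h₂)
  upper : ∀ r s j, r < s → j < α s → A r s j = upperFormula α B C A r s j

lemma AgreeBefore.next {j : ℕ} {A A' : Coeffs m} (h : AgreeBefore α j N A A') :
    AgreeBefore α (j + 1) 0 A A' := by
  intro r s n hr hs hn
  refine h r s n hr hs ?_
  have := s.isLt
  rcases hn with hn | hn | hn
  · exact Or.inl hn
  · omega
  · exact Or.inl (Fin.lt_def.2 (by omega))

/-- The formulas of the algorithm determine all blocks that occur in the block matrix. -/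
lemma Follows.unique (hα : StrictAnti α) {B B' C C' : DiagCoeffs m} {P : Params α m}
    {A A' : Coeffs m}
    (hB : ∀ r, ∀ l < α r, B r l = B' r l) (hC : ∀ r, ∀ l < α r, C r l = C' r l)
    (h : Follows B C P A) (h' : Follows B' C' P A') :
    ∀ r s n, n < α r → n < α s → A r s n = A' r s n := by
  have hlow : ∀ r s n, n < α r → s < r → A r s n = A' r s n := fun r s n hr hs => by
    rw [h.lower r s n hs hr, h'.lower r s n hs hr]
  -- Induction over the rounds, and within a round over the distance p from the diagonal. At the
  -- start of round 0 only the blocks below the diagonal are known.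
  have main : ∀ j, AgreeBefore α j 0 A A' := by
    intro j
    induction j with
    | zero =>
      intro r s n hr hs hn
      exact hlow r s n hr (by rw [Fin.lt_def] at *; omega)
    | succ j ih =>
      have inner : ∀ p, AgreeBefore α j (p + 1) A A' := by
        intro p
        induction p with
        | zero =>
          intro r s n hr hs hn
          by_cases hrs : r = s ∧ n = j
          · obtain ⟨rfl, rfl⟩ := hrs
            rcases Nat.eq_zero_or_pos n with rfl | hn₀
            · rw [h.diag_zero, h'.diag_zero]
            · rw [h.diag r n hn₀ hr, h'.diag r n hn₀ hr, diagFormula_congr hα hB hC hn₀ hr ih]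
          · refine ih r s n hr hs ?_
            rw [Fin.ext_iff] at hrs
            rw [Fin.lt_def] at *
            omega
        | succ p ihp =>
          intro r s n hr hs hn
          by_cases hrs : s.val = r.val + (p + 1) ∧ n = j
          · obtain ⟨hrs, rfl⟩ := hrs
            have hlt : r < s := by rw [Fin.lt_def]; omega
            rw [h.upper r s n hlt hs, h'.upper r s n hlt hs,
              upperFormula_congr hα hB hC hrs (by omega) hs ihp]
          · exact ihp r s n hr hs (by rw [Fin.lt_def] at *; omega)
      refine AgreeBefore.next fun r s n hr hs hn => inner N r s n hr hs ?_
      omega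
  intro r s n hr hs
  exact main (n + 1) r s n hr hs (by omega)

/-- The state of the algorithm before round `j`. -/
noncomputable def roundState (B C : DiagCoeffs m) (P : Params α m) (j : ℕ) : Coeffs m :=
  (List.range j).foldl
    (fun A j => (List.range (N - 1)).foldl
      (fun A' q => upperStep α B C j (q + 1) A') (diagStep B C P j A))
    (initState P)

/-- The state of the algorithm in round `j`, before the assignment of the `A_j^{r(r+p+1)}`. -/
noncomputable def stepState (B C : DiagCoeffs m) (P : Params α m) (j p : ℕ) : Coeffs m :=
  (List.range p).foldl (fun A' q => upperStep α B C j (q + 1) A')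
    (diagStep B C P j (roundState B C P j))

lemma stepState_zero (B C : DiagCoeffs m) (P : Params α m) (j : ℕ) :
    stepState B C P j 0 = diagStep B C P j (roundState B C P j) := rfl

lemma stepState_succ (B C : DiagCoeffs m) (P : Params α m) (j p : ℕ) :
    stepState B C P j (p + 1) = upperStep α B C j (p + 1) (stepState B C P j p) := by
  simp [stepState, List.range_succ]

lemma roundState_succ (B C : DiagCoeffs m) (P : Params α m) (j : ℕ) :
    roundState B C P (j + 1) = stepState B C P j (N - 1) := by
  simp [roundState, stepState, List.range_succ]

lemma diagStep_of_ne (B C : DiagCoeffs m) (P : Params α m) (j : ℕ) (A : Coeffs m) {r s : Fin N}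
    {n : ℕ} (h : s ≠ r ∨ n ≠ j ∨ j = 0) : diagStep B C P j A r s n = A r s n := by
  unfold diagStep
  split_ifs with hj
  · by_cases hs : s = r
    · subst hs
      rw [Function.update_self, Function.update_of_ne (by omega)]
    · rw [Function.update_of_ne hs]
  · rfl

lemma stepState_eq_of_le (B C : DiagCoeffs m) (P : Params α m) (j : ℕ) {p p' : ℕ} (hp : p ≤ p')
    {r s : Fin N} {n : ℕ} (h : n ≠ j ∨ s.val ≤ r.val + p) :
    stepState B C P j p' r s n = stepState B C P j p r s n := by
  induction p', hp using Nat.le_induction with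
  | base => rfl
  | succ q hq ih =>
    rw [stepState_succ, upperStep, if_neg (by omega), ih]

lemma roundState_succ_eq (B C : DiagCoeffs m) (P : Params α m) (j : ℕ) {r s : Fin N} {n : ℕ}
    (h : s < r ∨ n ≠ j ∨ (s = r ∧ j = 0)) :
    roundState B C P (j + 1) r s n = roundState B C P j r s n := by
  rw [roundState_succ, stepState_eq_of_le B C P j (Nat.zero_le _), stepState_zero, diagStep_of_ne]
  · rcases h with h | h | h
    · exact Or.inl h.ne
    · exact Or.inr (Or.inl h)
    · exact Or.inr (Or.inr h.2)
  · rcases h with h | h | h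
    · rw [Fin.lt_def] at h; omega
    · exact Or.inl h
    · right; rw [h.1]; omega

lemma roundState_eq_of_le (B C : DiagCoeffs m) (P : Params α m) {j j' : ℕ} (hj : j ≤ j')
    {r s : Fin N} {n : ℕ} (h : s < r ∨ n < j ∨ (s = r ∧ n = 0)) :
    roundState B C P j' r s n = roundState B C P j r s n := by
  induction j', hj using Nat.le_induction with
  | base => rfl
  | succ q hq ih =>
    rw [roundState_succ_eq, ih]
    rcases h with h | h | h
    · exact Or.inl h
    · right; left; omega
    · rcases Nat.eq_zero_or_pos q with h' | h'
      · exact Or.inr (Or.inr ⟨h.1, h'⟩)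
      · right; left; omega

lemma algorithm_eq_roundState (B C : DiagCoeffs m) (P : Params α m) :
    algorithm B C P = roundState B C P (Finset.univ.sup α) := rfl

/-- Each block is assigned at most once, so the value it has when it becomes known is final. -/
lemma algorithm_eq_stepState (B C : DiagCoeffs m) (P : Params α m) {j p : ℕ}
    (hj : j < Finset.univ.sup α) (hp : p ≤ N - 1) {r s : Fin N} {n : ℕ}
    (h : s < r ∨ n < j ∨ (n = j ∧ s.val ≤ r.val + p)) :
    algorithm B C P r s n = stepState B C P j p r s n := by
  have e : stepState B C P j (N - 1) r s n = stepState B C P j p r s n := by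
    refine stepState_eq_of_le B C P j hp ?_
    rw [Fin.lt_def] at h; omega
  rw [← e, ← roundState_succ, algorithm_eq_roundState]
  exact roundState_eq_of_le B C P hj (by omega)

lemma initState_diag_zero (P : Params α m) (r : Fin N) : initState P r r 0 = P.diag r := by
  simp [initState]

lemma initState_lower (P : Params α m) {r s : Fin N} {j : ℕ} (h₁ : s < r) (h₂ : j < α r) :
    initState P r s j = P.lower r s j h₁ h₂ := by
  simp [initState, Function.update_of_ne h₁.ne, h₁, h₂]

lemma follows_algorithm (hα : StrictAnti α) (B C : DiagCoeffs m) (P : Params α m) :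
    Follows B C P (algorithm B C P) := by
  have hsup : ∀ {r : Fin N} {j : ℕ}, j < α r → j < Finset.univ.sup α := fun {r j} h =>
    h.trans_le (Finset.le_sup (Finset.mem_univ r))
  refine ⟨fun r => ?_, fun r s j h₁ h₂ => ?_, fun r j h₁ h₂ => ?_, fun r s j h₁ h₂ => ?_⟩
  · rw [algorithm_eq_roundState, roundState_eq_of_le B C P (Nat.zero_le _)
      (Or.inr (Or.inr ⟨rfl, rfl⟩))]
    exact initState_diag_zero P r
  · rw [algorithm_eq_roundState, roundState_eq_of_le B C P (Nat.zero_le _) (Or.inl h₁)]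
    exact initState_lower P h₁ h₂
  -- The formula was evaluated in an intermediate state, but it reads only blocks that are final
  -- there. It therefore also holds for the final blocks.
  · have hag : AgreeBefore α j 0 (roundState B C P j) (algorithm B C P) := by
      intro r s n _ _ hn
      rw [algorithm_eq_roundState]
      symm
      refine roundState_eq_of_le B C P (hsup h₂).le ?_
      rw [Fin.lt_def] at *; omega
    rw [algorithm_eq_stepState B C P (hsup h₂) (Nat.zero_le _) (by omega), stepState_zero,
      ← diagFormula_congr hα (fun _ _ _ => rfl) (fun _ _ _ => rfl) h₁ h₂ hag]
    simp [diagStep, h₁, h₂]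
  · obtain ⟨q, hq⟩ : ∃ q, s.val = r.val + (q + 1) :=
      ⟨s.val - r.val - 1, by rw [Fin.lt_def] at h₁; omega⟩
    have hs := s.isLt
    have hag : AgreeBefore α j (q + 1) (stepState B C P j q) (algorithm B C P) := by
      intro r s n _ _ hn
      symm
      exact algorithm_eq_stepState B C P (hsup h₂) (by omega) (by omega)
    rw [algorithm_eq_stepState B C P (p := q + 1) (hsup h₂) (by omega) (by omega),
      stepState_succ, upperStep, if_pos ⟨hq, rfl, h₂⟩,
      upperFormula_congr hα (fun _ _ _ => rfl) (fun _ _ _ => rfl) hq (by omega) h₂ hag]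

end

/-! ### The bijection between choices and solutions -/

section

variable {N : ℕ} {α m : Fin N → ℕ}

section Congruence

variable {n : Type*} [Fintype n] [DecidableEq n] {B C A : Matrix n n ℂ}

/-- This is the origin of the factor A_0 C_0⁻¹ in the formulas: it inverts A_0ᵀ B_0, the coefficient
of the unknown. -/
lemma transpose_mul_mul_mul_inv (hC : IsUnit C) (h : C = Aᵀ * B * A) :
    Aᵀ * B * (A * C⁻¹) = 1 := by
  rw [← Matrix.mul_assoc, ← h, Matrix.mul_nonsing_inv _ ((Matrix.isUnit_iff_isUnit_det C).1 hC)]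

lemma mul_inv_mul_transpose_mul (hC : IsUnit C) (h : C = Aᵀ * B * A) :
    A * C⁻¹ * (Aᵀ * B) = 1 :=
  mul_eq_one_comm.1 (transpose_mul_mul_mul_inv hC h)

end Congruence

lemma Follows.admissible_diag {B C : DiagCoeffs m} {P : Params α m} {A : Coeffs m}
    (hA : Follows B C P A) (hP : P.Admissible B C) (r : Fin N) :
    C r 0 = (A r r 0)ᵀ * B r 0 * A r r 0 := by
  rw [hA.diag_zero, ← hP.1]

lemma Follows.mem_solutions (hα : StrictAnti α) {B C : DiagCoeffs m}
    (hB : ∀ r, ∀ j < α r, (B r j).IsSymm) (hC : ∀ r, ∀ j < α r, (C r j).IsSymm)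
    (hC₀ : ∀ r, IsUnit (C r 0)) {P : Params α m} {A : Coeffs m}
    (hA : Follows B C P A) (hP : P.Admissible B C) :
    blockToeplitz α A ∈ solutions α B C := by
  rw [blockToeplitz_mem_solutions_iff]
  have hupper : ∀ r s n, r < s → n < α s → formC α B A r s n = 0 := by
    intro r s n hrs hs
    rw [formC_upper hα B A hrs, hA.upper r s n hrs hs, upperFormula, Matrix.mul_neg,
      ← Matrix.mul_assoc, transpose_mul_mul_mul_inv (hC₀ r) (hA.admissible_diag hP r),
      Matrix.one_mul, neg_add_cancel]
  intro r s n hr hs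
  rcases lt_trichotomy r s with hrs | rfl | hrs
  · rw [hupper r s n hrs hs, diagC_ne C hrs.ne]
  · rw [diagC_same]
    rcases Nat.eq_zero_or_pos n with rfl | hn
    · rw [formC_diag_zero hα, hA.admissible_diag hP r]
    · have hs := transpose_formC hB A hr hr
      rw [formC_diag hα B A r hn] at hs ⊢
      have h₁ : (A r r 0)ᵀ * B r 0 * A r r n =
          P.skew r n hn hr + (1 / 2 : ℂ) • (C r n - diagD α B A r n) := by
        rw [hA.diag r n hn hr, diagFormula, ← Matrix.mul_assoc,
          transpose_mul_mul_mul_inv (hC₀ r) (hA.admissible_diag hP r), Matrix.one_mul]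
      have h₂ : (A r r n)ᵀ * B r 0 * A r r 0 = ((A r r 0)ᵀ * B r 0 * A r r n)ᵀ := by
        rw [Matrix.transpose_mul, Matrix.transpose_mul, Matrix.transpose_transpose,
          (hB r 0 (by omega)).eq, Matrix.mul_assoc]
      -- The coefficient S + Sᵀ + D is symmetric, so D is. Then Z cancels against its transpose and
      -- the two halves of C - D add up.
      have hD : (diagD α B A r n)ᵀ = diagD α B A r n := by
        rw [h₂, Matrix.transpose_add, Matrix.transpose_add, Matrix.transpose_transpose,
          add_comm (((A r r 0)ᵀ * B r 0 * A r r n)ᵀ)] at hs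
        exact add_left_cancel hs
      rw [h₂, h₁, Matrix.transpose_add, Matrix.transpose_smul, Matrix.transpose_sub, hD,
        (hC r n hr).eq, hP.2 r n hn hr]
      module
  · rw [← transpose_formC hB A hr hs, hupper s r n hrs hr, diagC_ne C hrs.ne',
      Matrix.transpose_zero]

/-- Multiplication by A_0ᵀ B_0 on the left removes the invertible factor and recovers Z. -/
lemma diagFormula_injective {B C : DiagCoeffs m} {A : Coeffs m} {r : Fin N}
    (hC₀ : IsUnit (C r 0)) (hA : C r 0 = (A r r 0)ᵀ * B r 0 * A r r 0) {j : ℕ} :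
    Function.Injective (diagFormula α B C A r j) := by
  intro Z Z' h
  have := congrArg (fun M => (A r r 0)ᵀ * B r 0 * M) h
  simp only [diagFormula] at this
  rw [← Matrix.mul_assoc, ← Matrix.mul_assoc _ _ (Z' + _), transpose_mul_mul_mul_inv hC₀ hA,
    Matrix.one_mul, Matrix.one_mul] at this
  exact add_right_cancel this

/-- The data of which a solution is the result. -/
noncomputable def paramsOf (α : Fin N → ℕ) (B C : DiagCoeffs m) (A : Coeffs m) : Params α m where
  diag r := A r r 0
  lower r s j _ _ := A r s j
  skew r j _ _ := (A r r 0)ᵀ * B r 0 * A r r j - (1 / 2 : ℂ) • (C r j - diagD α B A r j)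

/-- With S = A_0ᵀ B_0 A_j the equation S + Sᵀ = C_j - D_j says that S - (C_j - D_j)/2 is
skew-symmetric; this is Z_j. Solving back for A_j yields the formula. -/
lemma paramsOf_spec (hα : StrictAnti α) (hα_pos : ∀ r, 0 < α r) {B C : DiagCoeffs m}
    (hB : ∀ r, ∀ j < α r, (B r j).IsSymm)
    (hC₀ : ∀ r, IsUnit (C r 0)) {A : Coeffs m} (hA : blockToeplitz α A ∈ solutions α B C) :
    (paramsOf α B C A).Admissible B C ∧ Follows B C (paramsOf α B C A) A := by
  rw [blockToeplitz_mem_solutions_iff] at hA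
  have h₀ : ∀ r, C r 0 = (A r r 0)ᵀ * B r 0 * A r r 0 := fun r => by
    rw [← formC_diag_zero hα, ← hA r r 0 (hα_pos r) (hα_pos r), diagC_same]
  refine ⟨⟨h₀, fun r j h₁ h₂ => ?_⟩, fun _ => rfl, fun _ _ _ _ _ => rfl, fun r j h₁ h₂ => ?_,
    fun r s j hrs hs => ?_⟩
  · have := hA r r j h₂ h₂
    rw [diagC_same, formC_diag hα B A r h₁] at this
    have h₂ : (A r r j)ᵀ * B r 0 * A r r 0 = ((A r r 0)ᵀ * B r 0 * A r r j)ᵀ := by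
      rw [Matrix.transpose_mul, Matrix.transpose_mul, Matrix.transpose_transpose,
        (hB r 0 (hα_pos r)).eq, Matrix.mul_assoc]
    simp only [paramsOf]
    rw [this, h₂, add_sub_cancel_right, Matrix.transpose_sub, Matrix.transpose_smul,
      Matrix.transpose_add, Matrix.transpose_transpose]
    module
  · rw [diagFormula]
    simp only [paramsOf]
    rw [sub_add_cancel, ← Matrix.mul_assoc, mul_inv_mul_transpose_mul (hC₀ r) (h₀ r),
      Matrix.one_mul]
  · have := hA r s j (hs.trans (hα hrs)) hs
    rw [diagC_ne C hrs.ne, formC_upper hα B A hrs] at this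
    rw [upperFormula, ← Matrix.mul_neg, ← eq_neg_of_add_eq_zero_left this.symm,
      ← Matrix.mul_assoc, mul_inv_mul_transpose_mul (hC₀ r) (h₀ r), Matrix.one_mul]

lemma Follows.params_unique (hα : StrictAnti α) (hα_pos : ∀ r, 0 < α r) {B B' C C' : DiagCoeffs m}
    (hB : ∀ r, ∀ l < α r, B r l = B' r l) (hC : ∀ r, ∀ l < α r, C r l = C' r l)
    (hC₀ : ∀ r, IsUnit (C r 0)) {P P' : Params α m} {A A' : Coeffs m}
    (hP : P.Admissible B C) (h : Follows B C P A) (h' : Follows B' C' P' A')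
    (hA : ∀ r s n, n < α r → n < α s → A r s n = A' r s n) : P = P' := by
  have e₁ : P.diag = P'.diag := by
    funext r
    rw [← h.diag_zero, ← h'.diag_zero, hA r r 0 (hα_pos r) (hα_pos r)]
  have e₂ : P.lower = P'.lower := by
    funext r s j h₁ h₂
    rw [← h.lower, ← h'.lower, hA r s j h₂ (h₂.trans (hα h₁))]
  have e₃ : P.skew = P'.skew := by
    funext r j h₁ h₂
    apply diagFormula_injective (hC₀ r) (h.admissible_diag hP r) (j := j)
    rw [← h.diag, hA r r j h₂ h₂, h'.diag r j h₁ h₂,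
      diagFormula_congr hα hB hC h₁ h₂ fun r s n hr hs _ => hA r s n hr hs]
  cases P; cases P'
  simp only at e₁ e₂ e₃
  subst e₁ e₂ e₃
  rfl

lemma bijOn_algorithm (hα : StrictAnti α) (hα_pos : ∀ r, 0 < α r) {B C : DiagCoeffs m}
    (hB : ∀ r, ∀ j < α r, (B r j).IsSymm) (hC : ∀ r, ∀ j < α r, (C r j).IsSymm)
    (hC₀ : ∀ r, IsUnit (C r 0)) :
    Set.BijOn (fun P : Params α m => blockToeplitz α (algorithm B C P))
      {P | P.Admissible B C} (solutions α B C) := by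
  refine ⟨fun P hP => (follows_algorithm hα B C P).mem_solutions hα hB hC hC₀ hP, ?_, ?_⟩
  · intro P hP P' hP' h
    exact (follows_algorithm hα B C P).params_unique hα hα_pos (fun _ _ _ => rfl)
      (fun _ _ _ => rfl) hC₀ hP (follows_algorithm hα B C P') (blockToeplitz_inj.1 h)
  · intro X hX
    obtain ⟨A, rfl⟩ := hX.1
    obtain ⟨h₁, h₂⟩ := paramsOf_spec hα hα_pos hB hC₀ hX
    exact ⟨paramsOf α B C A, h₁, blockToeplitz_inj.2 ((follows_algorithm hα B C _).unique hα
      (fun _ _ _ => rfl) (fun _ _ _ => rfl) h₂)⟩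

/-! ### Complex conjugation and real solutions -/

section Real

/-- The entrywise complex conjugate. -/
def conjM {p q : Type*} (M : Matrix p q ℂ) : Matrix p q ℂ := M.map (starRingEnd ℂ)

lemma isRealMatrix_iff {p q : Type*} {M : Matrix p q ℂ} : IsRealMatrix M ↔ conjM M = M := by
  simp only [IsRealMatrix, ← Matrix.ext_iff, conjM, Matrix.map_apply, Complex.conj_eq_iff_im]

lemma conjM_mul {p q t : Type*} [Fintype q] (M : Matrix p q ℂ) (M' : Matrix q t ℂ) :
    conjM (M * M') = conjM M * conjM M' := Matrix.map_mul

lemma conjM_add {p q : Type*} (M M' : Matrix p q ℂ) : conjM (M + M') = conjM M + conjM M' := by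
  ext; simp [conjM]

lemma conjM_sub {p q : Type*} (M M' : Matrix p q ℂ) : conjM (M - M') = conjM M - conjM M' := by
  ext; simp [conjM]

lemma conjM_neg {p q : Type*} (M : Matrix p q ℂ) : conjM (-M) = -conjM M := by
  ext; simp [conjM]

lemma conjM_half {p q : Type*} (M : Matrix p q ℂ) :
    conjM ((1 / 2 : ℂ) • M) = (1 / 2 : ℂ) • conjM M := by
  ext; simp [conjM, Complex.conj_ofNat]

lemma conjM_transpose {p q : Type*} (M : Matrix p q ℂ) : conjM Mᵀ = (conjM M)ᵀ := rfl

lemma conjM_zero {p q : Type*} : conjM (0 : Matrix p q ℂ) = 0 := by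
  ext; simp [conjM]

lemma conjM_sum {p q ι : Type*} (s : Finset ι) (f : ι → Matrix p q ℂ) :
    conjM (∑ i ∈ s, f i) = ∑ i ∈ s, conjM (f i) := by
  ext; simp [conjM, Matrix.sum_apply]

lemma conjM_inv {p : Type*} [Fintype p] [DecidableEq p] (M : Matrix p p ℂ) :
    conjM M⁻¹ = (conjM M)⁻¹ := by
  -- Conjugation is the conjugate transpose followed by the transpose, and both commute with
  -- inversion.
  have h : ∀ M : Matrix p p ℂ, conjM M = Mᴴᵀ := fun _ => rfl
  rw [h, h, Matrix.conjTranspose_nonsing_inv, Matrix.transpose_nonsing_inv]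

/-- The conjugates of the blocks `A_j^{rs}`. -/
def conjC (A : Coeffs m) : Coeffs m := fun r s n => conjM (A r s n)

/-- The conjugates of the blocks `B_j^r`. -/
def conjD (B : DiagCoeffs m) : DiagCoeffs m := fun r n => conjM (B r n)

lemma conjM_phi (B : DiagCoeffs m) (A : Coeffs m) (k s : Fin N) (n : ℕ) :
    conjM (phi B A k s n) = phi (conjD B) (conjC A) k s n := by
  simp only [phi, conjM_sum, conjM_mul, conjC, conjD]

lemma conjM_psi (B : DiagCoeffs m) (A : Coeffs m) (k r s : Fin N) (z : ℤ) :
    conjM (psi B A k r s z) = psi (conjD B) (conjC A) k r s z := by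
  cases z with
  | ofNat n => simp only [psi, conjM_sum, conjM_mul, conjM_transpose, conjM_phi, conjC]
  | negSucc n => exact conjM_zero

lemma conjM_diagFormula (B C : DiagCoeffs m) (A : Coeffs m) (r : Fin N) (j : ℕ)
    (Z : Matrix (Fin (m r)) (Fin (m r)) ℂ) :
    conjM (diagFormula α B C A r j Z) =
      diagFormula α (conjD B) (conjD C) (conjC A) r j (conjM Z) := by
  simp only [diagFormula, diagD, conjM_mul, conjM_add, conjM_sub, conjM_half, conjM_sum,
    conjM_phi, conjM_psi, conjM_transpose, conjM_inv]
  rfl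

lemma conjM_upperFormula (B C : DiagCoeffs m) (A : Coeffs m) (r s : Fin N) (j : ℕ) :
    conjM (upperFormula α B C A r s j) =
      upperFormula α (conjD B) (conjD C) (conjC A) r s j := by
  simp only [upperFormula, upperD, conjM_mul, conjM_add, conjM_neg, conjM_sum,
    conjM_phi, conjM_psi, conjM_transpose, conjM_inv]
  rfl

/-- The conjugates of the chosen matrices. -/
def Params.conj (P : Params α m) : Params α m where
  diag r := conjM (P.diag r)
  lower r s j h₁ h₂ := conjM (P.lower r s j h₁ h₂)
  skew r j h₁ h₂ := conjM (P.skew r j h₁ h₂)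

lemma Params.isReal_iff {P : Params α m} : P.IsReal ↔ P = P.conj := by
  cases P
  simp only [Params.IsReal, isRealMatrix_iff, Params.conj, Params.mk.injEq, funext_iff]
  simp only [eq_comm]

/-- The formulas are built from sums, products, transposes, inverses and the real scalar 1/2, all
compatible with conjugation. -/
lemma Follows.conj {B C : DiagCoeffs m} {P : Params α m} {A : Coeffs m}
    (h : Follows B C P A) : Follows (conjD B) (conjD C) P.conj (conjC A) := by
  refine ⟨fun r => ?_, fun r s j h₁ h₂ => ?_, fun r j h₁ h₂ => ?_, fun r s j h₁ h₂ => ?_⟩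
  · rw [conjC, h.diag_zero]; rfl
  · rw [conjC, h.lower r s j h₁ h₂]; rfl
  · rw [conjC, h.diag r j h₁ h₂, conjM_diagFormula]; rfl
  · rw [conjC, h.upper r s j h₁ h₂, conjM_upperFormula]

lemma conjM_blockToeplitz (A : Coeffs m) :
    conjM (blockToeplitz α A) = blockToeplitz α (conjC A) := by
  ext ⟨r, i, x⟩ ⟨s, j, y⟩
  simp only [conjM, blockToeplitz, rectToeplitz, Matrix.map_apply, conjC]
  split_ifs <;> simp

lemma isRealMatrix_blockToeplitz_iff {A : Coeffs m} :
    IsRealMatrix (blockToeplitz α A) ↔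
      ∀ r s n, n < α r → n < α s → A r s n = conjC A r s n := by
  rw [isRealMatrix_iff, conjM_blockToeplitz, eq_comm, blockToeplitz_inj]

lemma isRealMatrix_diagToeplitz_iff {B : DiagCoeffs m} :
    IsRealMatrix (diagToeplitz α B) ↔ ∀ r, ∀ j < α r, B r j = conjD B r j := by
  rw [diagToeplitz_eq, isRealMatrix_blockToeplitz_iff]
  constructor
  · intro h r j hj
    simpa [conjC, conjD] using h r r j hj hj
  · intro h r s n hr _
    by_cases hrs : r = s
    · subst hrs; simpa [conjC, conjD] using h r n hr
    · rw [conjC, diagC_ne B hrs, conjM_zero]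

/-- The conjugated blocks follow the conjugated data. Uniqueness of the data for given blocks gives
one direction, uniqueness of the blocks for given data the other. -/
lemma isRealMatrix_algorithm_iff (hα : StrictAnti α) (hα_pos : ∀ r, 0 < α r)
    {B C : DiagCoeffs m} (hC₀ : ∀ r, IsUnit (C r 0))
    (hB : IsRealMatrix (diagToeplitz α B)) (hC : IsRealMatrix (diagToeplitz α C))
    {P : Params α m} (hP : P.Admissible B C) :
    IsRealMatrix (blockToeplitz α (algorithm B C P)) ↔ P.IsReal := by
  rw [isRealMatrix_diagToeplitz_iff] at hB hC
  have h := follows_algorithm hα B C P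
  rw [isRealMatrix_blockToeplitz_iff, Params.isReal_iff]
  constructor
  · exact fun hr => h.params_unique hα hα_pos hB hC hC₀ hP h.conj hr
  · intro hr
    have h' := h.conj
    rw [← hr] at h'
    exact h.unique hα hB hC h'

end Real

end

/-! ### Congruence of symmetric matrices as equivalence of quadratic forms -/

section QuadraticForms

variable {n : Type*} [Fintype n] [DecidableEq n] {K : Type*} [Field K]

lemma associated_toQuadraticForm' [Invertible (2 : K)] {M : Matrix n n K} (hM : M.IsSymm) :
    QuadraticMap.associated (R := K) M.toQuadraticForm' = Matrix.toLinearMap₂' K M := by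
  refine QuadraticMap.associated_left_inverse K ?_
  intro x y
  rw [Matrix.toLinearMap₂'_apply', Matrix.toLinearMap₂'_apply', dotProduct_comm,
    ← Matrix.vecMul_transpose, hM.eq, dotProduct_mulVec]

lemma toMatrix'_toQuadraticForm' [Invertible (2 : K)] {M : Matrix n n K} (hM : M.IsSymm) :
    M.toQuadraticForm'.toMatrix' = M := by
  rw [QuadraticForm.toMatrix', associated_toQuadraticForm' hM, LinearMap.toMatrix'_toLinearMap₂']

lemma separatingLeft_associated_toQuadraticForm' [Invertible (2 : K)] {M : Matrix n n K}
    (hM : M.IsSymm) (hu : IsUnit M) :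
    (QuadraticMap.associated (R := K) M.toQuadraticForm').SeparatingLeft := by
  rw [associated_toQuadraticForm' hM]
  exact LinearMap.separatingLeft_toLinearMap₂'_of_det_ne_zero'
    ((Matrix.isUnit_iff_isUnit_det M).1 hu).ne_zero

lemma exists_congruence_of_equivalent [Invertible (2 : K)] {M M' : Matrix n n K} (hM : M.IsSymm)
    (hM' : M'.IsSymm)
    (h : QuadraticMap.Equivalent M.toQuadraticForm' M'.toQuadraticForm') :
    ∃ A : Matrix n n K, M = Aᵀ * M' * A := by
  obtain ⟨e⟩ := h
  have hc : M.toQuadraticForm' = M'.toQuadraticForm'.comp e.toLinearEquiv.toLinearMap := by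
    ext x
    exact (e.map_app x).symm
  have := congrArg QuadraticForm.toMatrix' hc
  rw [QuadraticForm.toMatrix'_comp, toMatrix'_toQuadraticForm' hM,
    toMatrix'_toQuadraticForm' hM'] at this
  exact ⟨_, this⟩

lemma equivalent_of_congruence {M M' A : Matrix n n K} (hA : IsUnit A) (h : M = Aᵀ * M' * A) :
    QuadraticMap.Equivalent M.toQuadraticForm' M'.toQuadraticForm' := by
  have hd := (Matrix.isUnit_iff_isUnit_det A).1 hA
  refine ⟨⟨Matrix.toLinearEquiv' A (Matrix.invertibleOfIsUnitDet A hd), fun x => ?_⟩⟩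
  change (Matrix.toLinearMap₂' K M') (A *ᵥ x) (A *ᵥ x) = (Matrix.toLinearMap₂' K M) x x
  rw [Matrix.toLinearMap₂'_apply', Matrix.toLinearMap₂'_apply', h, ← Matrix.mulVec_mulVec,
    ← Matrix.mulVec_mulVec, Matrix.dotProduct_mulVec x, Matrix.vecMul_transpose]

lemma toQuadraticForm'_diagonal (w : n → K) :
    (Matrix.diagonal w).toQuadraticForm' = QuadraticMap.weightedSumSquares K w := by
  ext x
  change (Matrix.toLinearMap₂' K (Matrix.diagonal w)) x x = _
  rw [Matrix.toLinearMap₂'_apply', QuadraticMap.weightedSumSquares_apply]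
  refine Finset.sum_congr rfl fun i _ => ?_
  rw [Matrix.mulVec_diagonal, smul_eq_mul]
  ring

/-- Nonsingular complex symmetric matrices of equal size are congruent. -/
lemma exists_congruence_complex {M M' : Matrix n n ℂ} (hM : M.IsSymm) (hM' : M'.IsSymm)
    (hu : IsUnit M) (hu' : IsUnit M') : ∃ A : Matrix n n ℂ, M = Aᵀ * M' * A :=
  exists_congruence_of_equivalent hM hM' (QuadraticForm.equivalent_of_isAlgClosed _ _
    (separatingLeft_associated_toQuadraticForm' hM hu)
    (separatingLeft_associated_toQuadraticForm' hM' hu'))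

lemma equivalent_weightedSumSquares_perm {ι : Type*} [Fintype ι] {w w' : ι → K}
    (σ : Equiv.Perm ι)
    (h : ∀ i, w' (σ i) = w i) :
    QuadraticMap.Equivalent (QuadraticMap.weightedSumSquares K w)
      (QuadraticMap.weightedSumSquares K w') := by
  refine ⟨⟨LinearEquiv.funCongrLeft K K σ.symm, fun x => ?_⟩⟩
  change QuadraticMap.weightedSumSquares K w' (fun i => x (σ.symm i)) = _
  rw [QuadraticMap.weightedSumSquares_apply, QuadraticMap.weightedSumSquares_apply,
    ← Equiv.sum_comp σ]
  simp [h]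

/-- Both forms are equivalent to sums of squares with weights ±1. Equal numbers of positive weights
allow a permutation to match them. -/
lemma equivalent_of_sigPos_eq {V : Type*} [AddCommGroup V] [Module ℝ V] [FiniteDimensional ℝ V]
    {Q Q' : QuadraticForm ℝ V}
    (hQ : (QuadraticMap.associated (R := ℝ) Q).SeparatingLeft)
    (hQ' : (QuadraticMap.associated (R := ℝ) Q').SeparatingLeft)
    (h : sigPos Q = sigPos Q') : QuadraticMap.Equivalent Q Q' := by
  classical
  obtain ⟨w, hw, e⟩ := Q.equivalent_one_neg_one_weighted_sum_squared hQ
  obtain ⟨w', hw', e'⟩ := Q'.equivalent_one_neg_one_weighted_sum_squared hQ'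
  rw [QuadraticForm.sigPos_of_equiv_weightedSumSquares e,
    QuadraticForm.sigPos_of_equiv_weightedSumSquares e'] at h
  have hc : Fintype.card {i // 0 < w i} = Fintype.card {i // 0 < w' i} := by
    rw [← Nat.card_eq_fintype_card, ← Nat.card_eq_fintype_card]
    exact h
  -- A bijection between the positive indices extends to a permutation that also matches the
  -- negative ones.
  let σ := (Fintype.equivOfCardEq hc).extendSubtype
  refine e.trans ((equivalent_weightedSumSquares_perm σ fun i => ?_).trans e'.symm)
  by_cases hi : 0 < w i
  · have hi' : 0 < w' (σ i) := (Fintype.equivOfCardEq hc).extendSubtype_mem i hi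
    rcases hw i with h₁ | h₁ <;> rcases hw' (σ i) with h₂ | h₂ <;> linarith
  · have hi' : ¬ 0 < w' (σ i) := (Fintype.equivOfCardEq hc).extendSubtype_not_mem i hi
    rcases hw i with h₁ | h₁ <;> rcases hw' (σ i) with h₂ | h₂ <;> linarith

lemma equivalent_weightedSumSquares_eigenvalues {R : Matrix n n ℝ} (hR : R.IsHermitian) :
    QuadraticMap.Equivalent R.toQuadraticForm'
      (QuadraticMap.weightedSumSquares ℝ hR.eigenvalues) := by
  rw [← toQuadraticForm'_diagonal]
  let U : Matrix n n ℝ := hR.eigenvectorUnitary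
  have hU : U * star U = 1 := Unitary.mul_star_self_of_mem hR.eigenvectorUnitary.2
  have hU' : Uᵀ = star U := by
    rw [Matrix.star_eq_conjTranspose, Matrix.conjTranspose_eq_transpose_of_trivial]
  -- The spectral theorem reads R = U D U*, and U* = Uᵀ over the reals.
  refine equivalent_of_congruence (A := Uᵀ) ?_ ?_
  · rw [hU']
    exact IsUnit.of_mul_eq_one U (mul_eq_one_comm.1 hU)
  · have := hR.spectral_theorem
    rw [Unitary.conjStarAlgAut_apply] at this
    rw [Matrix.transpose_transpose, hU']
    exact this

end QuadraticForms

/-! ### Inertia and Sylvester's law -/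

section Inertia

variable {n : ℕ}

/-- The real parts of the entries. -/
def reM {p q : Type*} (M : Matrix p q ℂ) : Matrix p q ℝ := M.map Complex.re

lemma map_reM {p q : Type*} {M : Matrix p q ℂ} (hM : IsRealMatrix M) :
    (reM M).map Complex.ofReal = M := by
  ext i j
  exact Complex.ext rfl (hM i j).symm

lemma isRealMatrix_map_ofReal {p q : Type*} (R : Matrix p q ℝ) :
    IsRealMatrix (R.map Complex.ofReal) := fun _ _ => rfl

lemma isSymm_reM {p : Type*} {M : Matrix p p ℂ} (hM : M.IsSymm) : (reM M).IsSymm := by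
  rw [Matrix.IsSymm, reM, ← Matrix.transpose_map, hM.eq]

lemma map_ofReal_mul {p q t : Type*} [Fintype q] (M : Matrix p q ℝ) (M' : Matrix q t ℝ) :
    (M * M').map Complex.ofReal = M.map Complex.ofReal * M'.map Complex.ofReal :=
  Matrix.map_mul (f := Complex.ofRealHom)

lemma isUnit_reM {p : Type*} [Fintype p] [DecidableEq p] {M : Matrix p p ℂ}
    (hM : IsRealMatrix M) (hu : IsUnit M) : IsUnit (reM M) := by
  rw [Matrix.isUnit_iff_isUnit_det, isUnit_iff_ne_zero] at hu ⊢
  intro h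
  apply hu
  rw [← map_reM hM]
  have := Complex.ofRealHom.map_det (reM M)
  rw [h, map_zero] at this
  exact this.symm

open Classical in
lemma inertia_eq_of_isHermitian {R : Matrix (Fin n) (Fin n) ℝ} (hR : R.IsHermitian) :
    inertia (R.map Complex.ofReal) = ((Finset.univ.filter fun i => 0 < hR.eigenvalues i).card,
      (Finset.univ.filter fun i => hR.eigenvalues i < 0).card,
      (Finset.univ.filter fun i => hR.eigenvalues i = 0).card) := by
  have hroots : (R.map Complex.ofReal).charpoly.roots =
      Finset.univ.val.map fun i => (hR.eigenvalues i : ℂ) := by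
    have h₁ : (R.map Complex.ofReal).charpoly = R.charpoly.map Complex.ofRealHom :=
      Matrix.charpoly_map R Complex.ofRealHom
    rw [h₁, hR.charpoly_eq, Polynomial.map_prod]
    simp only [Polynomial.map_sub, Polynomial.map_X, Polynomial.map_C]
    rw [← Polynomial.roots_multiset_prod_X_sub_C
      (Finset.univ.val.map fun i => (hR.eigenvalues i : ℂ)), Multiset.map_map]
    rfl
  simp only [inertia, hroots, Multiset.filter_map, Multiset.card_map]
  rfl

/-- A nonsingular real symmetric matrix has no zero eigenvalue, so its inertia is (p, n - p, 0) with
p the positive index of the form. -/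
lemma inertia_eq_iff_sigPos_eq {R R' : Matrix (Fin n) (Fin n) ℝ} (hR : R.IsSymm) (hR' : R'.IsSymm)
    (hu : IsUnit R) (hu' : IsUnit R') :
    inertia (R.map Complex.ofReal) = inertia (R'.map Complex.ofReal) ↔
      sigPos R.toQuadraticForm' = sigPos R'.toQuadraticForm' := by
  classical
  have key : ∀ {R : Matrix (Fin n) (Fin n) ℝ}, R.IsSymm → IsUnit R →
      inertia (R.map Complex.ofReal) =
        (sigPos R.toQuadraticForm', n - sigPos R.toQuadraticForm', 0) := by
    intro R hR hu
    have hH : R.IsHermitian := by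
      rw [Matrix.IsHermitian, Matrix.conjTranspose_eq_transpose_of_trivial, hR.eq]
    have hne : ∀ i, hH.eigenvalues i ≠ 0 := by
      have := ((Matrix.isUnit_iff_isUnit_det R).1 hu).ne_zero
      rw [hH.det_eq_prod_eigenvalues, Finset.prod_ne_zero_iff] at this
      exact fun i => by simpa using this i (Finset.mem_univ i)
    have hpos : sigPos R.toQuadraticForm' =
        (Finset.univ.filter fun i => 0 < hH.eigenvalues i).card := by
      rw [QuadraticForm.sigPos_of_equiv_weightedSumSquares
        (equivalent_weightedSumSquares_eigenvalues hH), Set.ncard_eq_toFinset_card']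
      congr 1
      ext; simp
    have hneg : (Finset.univ.filter fun i => hH.eigenvalues i < 0).card =
        n - (Finset.univ.filter fun i => 0 < hH.eigenvalues i).card := by
      have h := Finset.card_filter_add_card_filter_not (s := (Finset.univ : Finset (Fin n)))
        (fun i => 0 < hH.eigenvalues i)
      rw [Finset.card_univ, Fintype.card_fin] at h
      have h' : (Finset.univ.filter fun i => ¬ 0 < hH.eigenvalues i) =
          Finset.univ.filter fun i => hH.eigenvalues i < 0 := by
        ext i
        simp only [Finset.mem_filter, Finset.mem_univ, true_and, not_lt]
        exact ⟨fun hi => lt_of_le_of_ne hi (hne i), le_of_lt⟩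
      rw [h'] at h
      omega
    have hzero : (Finset.univ.filter fun i => hH.eigenvalues i = 0).card = 0 := by
      rw [Finset.card_eq_zero, Finset.filter_eq_empty_iff]
      exact fun i _ => hne i
    rw [inertia_eq_of_isHermitian hH, hpos]
    refine Prod.ext ?_ (Prod.ext ?_ ?_)
    · simp only
    · simp only
      rw [← hneg]
    · simp only
      rw [← hzero]
  rw [key hR hu, key hR' hu']
  constructor
  · intro h; exact (Prod.ext_iff.1 h).1
  · intro h; rw [h]

/-- Sylvester's law of inertia for nonsingular real symmetric matrices. -/
lemma exists_real_congruence_iff {M M' : Matrix (Fin n) (Fin n) ℂ} (hM : M.IsSymm)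
    (hM' : M'.IsSymm) (hu : IsUnit M) (hu' : IsUnit M') (hr : IsRealMatrix M)
    (hr' : IsRealMatrix M') :
    (∃ A : Matrix (Fin n) (Fin n) ℂ, IsRealMatrix A ∧ M' = Aᵀ * M * A) ↔
      inertia M = inertia M' := by
  rw [← map_reM hr, ← map_reM hr', inertia_eq_iff_sigPos_eq (isSymm_reM hM) (isSymm_reM hM')
    (isUnit_reM hr hu) (isUnit_reM hr' hu')]
  constructor
  · rintro ⟨A, hA, h⟩
    rw [← map_reM hA, ← Matrix.transpose_map, ← map_ofReal_mul, ← map_ofReal_mul] at h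
    have h' : reM M' = (reM A)ᵀ * reM M * reM A :=
      Matrix.map_injective Complex.ofReal_injective h
    have hAu : IsUnit (reM A) := by
      have := isUnit_reM hr' hu'
      rw [h', Matrix.isUnit_iff_isUnit_det, Matrix.det_mul] at this
      exact (Matrix.isUnit_iff_isUnit_det _).2 (isUnit_of_mul_isUnit_right this)
    exact (equivalent_of_congruence hAu h').sigPos_eq.symm
  · intro h
    obtain ⟨A, hA⟩ := exists_congruence_of_equivalent (isSymm_reM hM') (isSymm_reM hM)
      (equivalent_of_sigPos_eq
        (separatingLeft_associated_toQuadraticForm' (isSymm_reM hM') (isUnit_reM hr' hu'))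
        (separatingLeft_associated_toQuadraticForm' (isSymm_reM hM) (isUnit_reM hr hu)) h.symm)
    refine ⟨A.map Complex.ofReal, isRealMatrix_map_ofReal A, ?_⟩
    rw [hA, map_ofReal_mul, map_ofReal_mul, Matrix.transpose_map]

end Inertia

/-! ### The Cayley transform as a chart -/

section Cayley

variable {ι : Type*} [Fintype ι] {F : Type*} [NormedAddCommGroup F] [NormedSpace ℂ F]

lemma differentiableAt_finset_prod {κ : Type*} (s : Finset κ) {f : κ → F → ℂ} {x : F}
    (hf : ∀ k ∈ s, DifferentiableAt ℂ (f k) x) :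
    DifferentiableAt ℂ (fun y => ∏ k ∈ s, f k y) x := by
  classical
  induction s using Finset.induction_on with
  | empty => simp
  | insert k s hk ih =>
    simp only [Finset.prod_insert hk]
    exact (hf k (Finset.mem_insert_self k s)).mul
      (ih fun l hl => hf l (Finset.mem_insert_of_mem hl))

lemma differentiableAt_matrix_mul {f g : F → Matrix ι ι ℂ} {x : F}
    (hf : ∀ i j, DifferentiableAt ℂ (fun y => f y i j) x)
    (hg : ∀ i j, DifferentiableAt ℂ (fun y => g y i j) x) (i j : ι) :
    DifferentiableAt ℂ (fun y => (f y * g y) i j) x := by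
  simp only [Matrix.mul_apply]
  exact DifferentiableAt.fun_sum fun k _ => (hf i k).mul (hg k j)

variable [DecidableEq ι]

lemma differentiableAt_matrix_det {f : F → Matrix ι ι ℂ} {x : F}
    (hf : ∀ i j, DifferentiableAt ℂ (fun y => f y i j) x) :
    DifferentiableAt ℂ (fun y => (f y).det) x := by
  simp only [Matrix.det_apply]
  exact DifferentiableAt.fun_sum fun σ _ =>
    (differentiableAt_finset_prod _ fun k _ => hf _ _).const_smul _

lemma differentiableAt_matrix_inv {f : F → Matrix ι ι ℂ} {x : F}
    (hf : ∀ i j, DifferentiableAt ℂ (fun y => f y i j) x) (hx : (f x).det ≠ 0) (i j : ι) :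
    DifferentiableAt ℂ (fun y => (f y)⁻¹ i j) x := by
  simp only [Matrix.inv_def, Ring.inverse_eq_inv', Matrix.smul_apply, smul_eq_mul,
    Matrix.adjugate_apply]
  refine ((differentiableAt_matrix_det hf).inv hx).mul (differentiableAt_matrix_det fun k l => ?_)
  by_cases hk : k = j
  · subst hk
    simp only [Matrix.updateRow_self]
    exact differentiableAt_const _
  · simp only [Matrix.updateRow_ne hk]
    exact hf k l

/-- The Cayley transform `(Y - 1) (Y + 1)⁻¹`. -/
noncomputable def cayley (Y : Matrix ι ι ℂ) : Matrix ι ι ℂ := (Y - 1) * (Y + 1)⁻¹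

/-- The inverse Cayley transform `(1 + K) (1 - K)⁻¹`. -/
noncomputable def cayleyInv (K : Matrix ι ι ℂ) : Matrix ι ι ℂ := (1 + K) * (1 - K)⁻¹

lemma cayley_mul {Y : Matrix ι ι ℂ} (hY : (Y + 1).det ≠ 0) : cayley Y * (Y + 1) = Y - 1 := by
  rw [cayley, Matrix.mul_assoc, Matrix.nonsing_inv_mul _ hY.isUnit, Matrix.mul_one]

lemma cayleyInv_mul {K : Matrix ι ι ℂ} (hK : (1 - K).det ≠ 0) :
    cayleyInv K * (1 - K) = 1 + K := by
  rw [cayleyInv, Matrix.mul_assoc, Matrix.nonsing_inv_mul _ hK.isUnit, Matrix.mul_one]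

/-- Shows that 1 - K and Y + 1 are inverse up to the factor 2, so that the domains where the two
transforms are defined correspond. -/
lemma one_sub_cayley_mul {Y : Matrix ι ι ℂ} (hY : (Y + 1).det ≠ 0) :
    (1 - cayley Y) * (Y + 1) = (2 : ℂ) • 1 := by
  rw [Matrix.sub_mul, cayley_mul hY, Matrix.one_mul]
  module

lemma cayleyInv_add_one_mul {K : Matrix ι ι ℂ} (hK : (1 - K).det ≠ 0) :
    (cayleyInv K + 1) * (1 - K) = (2 : ℂ) • 1 := by
  rw [Matrix.add_mul, cayleyInv_mul hK, Matrix.one_mul]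
  module

lemma det_two_smul_one_ne_zero : ((2 : ℂ) • (1 : Matrix ι ι ℂ)).det ≠ 0 := by
  rw [Matrix.det_smul, Matrix.det_one, mul_one]
  exact pow_ne_zero _ two_ne_zero

lemma det_one_sub_cayley {Y : Matrix ι ι ℂ} (hY : (Y + 1).det ≠ 0) :
    (1 - cayley Y).det ≠ 0 := by
  have := det_two_smul_one_ne_zero (ι := ι)
  rw [← one_sub_cayley_mul hY, Matrix.det_mul] at this
  exact left_ne_zero_of_mul this

lemma det_cayleyInv_add_one {K : Matrix ι ι ℂ} (hK : (1 - K).det ≠ 0) :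
    (cayleyInv K + 1).det ≠ 0 := by
  have := det_two_smul_one_ne_zero (ι := ι)
  rw [← cayleyInv_add_one_mul hK, Matrix.det_mul] at this
  exact left_ne_zero_of_mul this

lemma mul_right_cancel_of_det {P Q V : Matrix ι ι ℂ} (hV : V.det ≠ 0) (h : P * V = Q * V) :
    P = Q :=
  ((Matrix.isUnit_iff_isUnit_det V).2 hV.isUnit).mul_right_cancel h

lemma cayleyInv_cayley {Y : Matrix ι ι ℂ} (hY : (Y + 1).det ≠ 0) : cayleyInv (cayley Y) = Y := by
  refine mul_right_cancel_of_det (det_one_sub_cayley hY) (mul_right_cancel_of_det hY ?_)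
  rw [cayleyInv_mul (det_one_sub_cayley hY), Matrix.mul_assoc, one_sub_cayley_mul hY,
    Matrix.add_mul, cayley_mul hY, Matrix.one_mul, Matrix.mul_smul, Matrix.mul_one]
  module

lemma cayley_cayleyInv {K : Matrix ι ι ℂ} (hK : (1 - K).det ≠ 0) : cayley (cayleyInv K) = K := by
  refine mul_right_cancel_of_det (det_cayleyInv_add_one hK) (mul_right_cancel_of_det hK ?_)
  rw [cayley_mul (det_cayleyInv_add_one hK), Matrix.mul_assoc, cayleyInv_add_one_mul hK,
    Matrix.sub_mul, cayleyInv_mul hK, Matrix.one_mul, Matrix.mul_smul, Matrix.mul_one]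
  module

lemma differentiableAt_mul_of_add_one (M : Matrix ι ι ℂ) (X : ι → ι → ℂ) (i j : ι) :
    DifferentiableAt ℂ (fun X : ι → ι → ℂ => (M * Matrix.of X + 1) i j) X := by
  simp only [Matrix.add_apply, Matrix.mul_apply, Matrix.of_apply]
  fun_prop

lemma differentiableAt_one_sub_of (K : ι → ι → ℂ) (i j : ι) :
    DifferentiableAt ℂ (fun K : ι → ι → ℂ => (1 - Matrix.of K) i j) K := by
  simp only [Matrix.sub_apply, Matrix.of_apply]
  fun_prop

lemma differentiableAt_cayley (M : Matrix ι ι ℂ) {X : ι → ι → ℂ}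
    (hX : (M * Matrix.of X + 1).det ≠ 0) :
    DifferentiableAt ℂ (fun X : ι → ι → ℂ => Matrix.of.symm (cayley (M * Matrix.of X))) X := by
  rw [differentiableAt_pi]
  intro i
  rw [differentiableAt_pi]
  intro j
  refine differentiableAt_matrix_mul (fun k l => ?_)
    (differentiableAt_matrix_inv (differentiableAt_mul_of_add_one M X) hX) i j
  simp only [Matrix.sub_apply, Matrix.mul_apply, Matrix.of_apply]
  fun_prop

lemma differentiableAt_cayleyInv (M : Matrix ι ι ℂ) {K : ι → ι → ℂ}
    (hK : (1 - Matrix.of K).det ≠ 0) :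
    DifferentiableAt ℂ (fun K : ι → ι → ℂ => Matrix.of.symm (M * cayleyInv (Matrix.of K))) K := by
  rw [differentiableAt_pi]
  intro i
  rw [differentiableAt_pi]
  intro j
  refine differentiableAt_matrix_mul (f := fun _ => M) (fun k l => differentiableAt_const _)
    (differentiableAt_matrix_mul (fun k l => ?_)
      (differentiableAt_matrix_inv (differentiableAt_one_sub_of K) hK)) i j
  simp only [Matrix.add_apply, Matrix.of_apply]
  fun_prop

/-- The chart `X ↦ cayley (X₀⁻¹ X)` of the space of matrices around an invertible `X₀`. -/
noncomputable def cayleyChart (X₀ : Matrix ι ι ℂ) (hX₀ : IsUnit X₀.det) :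
    OpenPartialHomeomorph (ι → ι → ℂ) (ι → ι → ℂ) where
  toFun X := Matrix.of.symm (cayley (X₀⁻¹ * Matrix.of X))
  invFun K := Matrix.of.symm (X₀ * cayleyInv (Matrix.of K))
  source := {X | (X₀⁻¹ * Matrix.of X + 1).det ≠ 0}
  target := {K | (1 - Matrix.of K).det ≠ 0}
  map_source' X hX := det_one_sub_cayley hX
  map_target' K hK := by
    simp only [Set.mem_ofPred_eq, Equiv.apply_symm_apply]
    rw [Matrix.nonsing_inv_mul_cancel_left _ _ hX₀]
    exact det_cayleyInv_add_one hK
  left_inv' X hX := by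
    simp only [Equiv.apply_symm_apply]
    rw [cayleyInv_cayley hX, Matrix.mul_nonsing_inv_cancel_left _ _ hX₀]
    rfl
  right_inv' K hK := by
    simp only [Equiv.apply_symm_apply]
    rw [Matrix.nonsing_inv_mul_cancel_left _ _ hX₀, cayley_cayleyInv hK]
    rfl
  open_source := by
    have h : Differentiable ℂ fun X : ι → ι → ℂ => (X₀⁻¹ * Matrix.of X + 1).det := fun X =>
      differentiableAt_matrix_det (differentiableAt_mul_of_add_one _ X)
    exact isOpen_compl_singleton.preimage h.continuous
  open_target := by
    have h : Differentiable ℂ fun K : ι → ι → ℂ => (1 - Matrix.of K).det := fun K =>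
      differentiableAt_matrix_det (differentiableAt_one_sub_of K)
    exact isOpen_compl_singleton.preimage h.continuous
  continuousOn_toFun X hX := (differentiableAt_cayley _ hX).continuousAt.continuousWithinAt
  continuousOn_invFun K hK := (differentiableAt_cayleyInv _ hK).continuousAt.continuousWithinAt

lemma differentiableOn_cayleyChart (X₀ : Matrix ι ι ℂ) (hX₀ : IsUnit X₀.det) :
    DifferentiableOn ℂ (cayleyChart X₀ hX₀) (cayleyChart X₀ hX₀).source := fun _ hX =>
  (differentiableAt_cayley _ hX).differentiableWithinAt

lemma differentiableOn_cayleyChart_symm (X₀ : Matrix ι ι ℂ) (hX₀ : IsUnit X₀.det) :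
    DifferentiableOn ℂ (cayleyChart X₀ hX₀).symm (cayleyChart X₀ hX₀).target := fun _ hK =>
  (differentiableAt_cayleyInv _ hK).differentiableWithinAt

/-- At the centre Y = 1, and Y + 1 = 2 is invertible. -/
lemma mem_cayleyChart_source (X₀ : Matrix ι ι ℂ) (hX₀ : IsUnit X₀.det) :
    Matrix.of.symm X₀ ∈ (cayleyChart X₀ hX₀).source := by
  change (X₀⁻¹ * X₀ + 1).det ≠ 0
  rw [Matrix.nonsing_inv_mul _ hX₀]
  have : (1 : Matrix ι ι ℂ) + 1 = (2 : ℂ) • 1 := by module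
  rw [this]
  exact det_two_smul_one_ne_zero

end Cayley

/-! ### The Toeplitz algebra and the submanifold structure -/

section Subalgebra

/-- Left multiplication by `M` is an injective endomorphism of the finite-dimensional space `S`,
hence surjective, and it attains 1. -/
lemma nonsing_inv_mem_subalgebra {ι : Type*} [Fintype ι] [DecidableEq ι]
    (S : Subalgebra ℂ (Matrix ι ι ℂ)) {M : Matrix ι ι ℂ} (hM : M ∈ S) (hd : IsUnit M.det) :
    M⁻¹ ∈ S := by
  let f : S →ₗ[ℂ] S := LinearMap.mulLeft ℂ ⟨M, hM⟩
  have hf : Function.Injective f := by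
    intro x y hxy
    have h : M * x = M * y := congrArg Subtype.val hxy
    exact Subtype.ext (((Matrix.isUnit_iff_isUnit_det M).2 hd).mul_left_cancel h)
  obtain ⟨y, hy⟩ := LinearMap.surjective_of_injective hf 1
  have hy' : M * y = 1 := congrArg Subtype.val hy
  rw [Matrix.inv_eq_right_inv hy']
  exact y.2

variable {N : ℕ} {α m : Fin N → ℕ}

lemma blockToeplitz_add (A A' : Coeffs m) :
    blockToeplitz α (A + A') = blockToeplitz α A + blockToeplitz α A' := by
  ext ⟨r, i, x⟩ ⟨s, j, y⟩
  simp only [blockToeplitz, rectToeplitz, Matrix.add_apply, Pi.add_apply]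
  split_ifs <;> simp

lemma blockToeplitz_smul (c : ℂ) (A : Coeffs m) :
    blockToeplitz α (c • A) = c • blockToeplitz α A := by
  ext ⟨r, i, x⟩ ⟨s, j, y⟩
  simp only [blockToeplitz, rectToeplitz, Matrix.smul_apply, Pi.smul_apply]
  split_ifs <;> simp

lemma diagToeplitz_one :
    diagToeplitz α (fun _ n => if n = 0 then 1 else 0 : DiagCoeffs m) = 1 := by
  rw [diagToeplitz, ← Matrix.blockDiagonal'_one]
  congr 1
  funext r
  ext ⟨i, x⟩ ⟨j, y⟩
  simp only [rectToeplitz, Nat.sub_self, add_zero, Pi.one_apply, Matrix.one_apply, Prod.mk.injEq,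
    Fin.ext_iff]
  by_cases h : i.val = j.val
  · simp [h, Matrix.one_apply, Fin.ext_iff]
  · by_cases hle : i.val ≤ j.val
    · have : ¬ j.val - i.val = 0 := by omega
      simp [h, hle, this]
    · simp [h, hle]

/-- The algebra of block Toeplitz matrices. -/
def toeplitzAlgebra (α m : Fin N → ℕ) : Subalgebra ℂ (Matrix (Idx α m) (Idx α m) ℂ) where
  carrier := Set.range (blockToeplitz α)
  mul_mem' := by
    rintro _ _ ⟨A, rfl⟩ ⟨A', rfl⟩
    exact ⟨_, (blockToeplitz_mul A A').symm⟩
  add_mem' := by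
    rintro _ _ ⟨A, rfl⟩ ⟨A', rfl⟩
    exact ⟨_, blockToeplitz_add A A'⟩
  algebraMap_mem' c := by
    rw [Algebra.algebraMap_eq_smul_one, ← diagToeplitz_one, diagToeplitz_eq,
      ← blockToeplitz_smul]
    exact ⟨_, rfl⟩

lemma mem_toeplitzAlgebra {X : Matrix (Idx α m) (Idx α m) ℂ} :
    X ∈ toeplitzAlgebra α m ↔ ∃ A, blockToeplitz α A = X := Iff.rfl

lemma diagToeplitz_mem (B : DiagCoeffs m) : diagToeplitz α B ∈ toeplitzAlgebra α m :=
  ⟨_, (diagToeplitz_eq B).symm⟩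

/-- The matrix is block triangular with `f 0` in every diagonal block, so its determinant is a power
of `det (f 0)`. -/
lemma isUnit_rectToeplitz {p : Type*} [Fintype p] [DecidableEq p] (a : ℕ)
    (f : ℕ → Matrix p p ℂ) (hf : IsUnit (f 0)) : IsUnit (rectToeplitz a a f) := by
  have ht : (rectToeplitz a a f).BlockTriangular (Prod.fst : Fin a × p → Fin a) := by
    intro x y hxy
    have : ¬ x.1.val + (a - a) ≤ y.1.val := by
      have := Fin.lt_def.1 hxy
      omega
    simp only [rectToeplitz, this, if_false]
  rw [Matrix.isUnit_iff_isUnit_det, ht.det_fintype, isUnit_iff_ne_zero, Finset.prod_ne_zero_iff]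
  intro k _
  let e : p ≃ {x : Fin a × p // x.1 = k} :=
    { toFun := fun x => ⟨(k, x), rfl⟩
      invFun := fun x => x.1.2
      left_inv := fun _ => rfl
      right_inv := by rintro ⟨⟨_, x⟩, rfl⟩; rfl }
  have he : ((rectToeplitz a a f).toSquareBlock Prod.fst k).submatrix e e = f 0 := by
    ext x y
    simp [Matrix.toSquareBlock_def, rectToeplitz, e]
  rw [← Matrix.det_submatrix_equiv_self e, he]
  exact ((Matrix.isUnit_iff_isUnit_det _).1 hf).ne_zero

lemma isUnit_diagToeplitz {C : DiagCoeffs m} (hC : ∀ r, IsUnit (C r 0)) :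
    IsUnit (diagToeplitz α C) := by
  have h : IsUnit (fun r => rectToeplitz (α r) (α r) (C r)) :=
    Pi.isUnit_iff.2 fun r => isUnit_rectToeplitz (α r) (C r) (hC r)
  exact h.map (Matrix.blockDiagonal'RingHom (fun r => Fin (α r) × Fin (m r)) ℂ)

/-- The block Toeplitz matrices `W` with `𝓕 Wᵀ 𝓕 = -W`. -/
def skewToeplitz (α m : Fin N → ℕ) : Submodule ℂ (Matrix (Idx α m) (Idx α m) ℂ) where
  carrier := {W | W ∈ toeplitzAlgebra α m ∧ flipT W = -W}
  add_mem' := by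
    rintro W W' ⟨h₁, h₂⟩ ⟨h₁', h₂'⟩
    refine ⟨add_mem h₁ h₁', ?_⟩
    rw [flipT_add, h₂, h₂', neg_add]
  zero_mem' := ⟨zero_mem _, by simp [flipT]⟩
  smul_mem' c W := by
    rintro ⟨h₁, h₂⟩
    refine ⟨Subalgebra.smul_mem _ h₁ c, ?_⟩
    rw [← smul_neg, ← h₂]
    simp [flipT]

/-- The Toeplitz algebra is closed under inverses, so X, Y and 𝓒 K lie in it simultaneously. Since
X₀* 𝓑 X₀ = 𝓒, the equation for X becomes Y* 𝓒 Y = 𝓒, which the Cayley transform turns into a linear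
condition on K. -/
lemma mem_solutions_iff_of_mem {B C : DiagCoeffs m}
    (hC : ∀ r, ∀ j < α r, (C r j).IsSymm) (hC₀ : ∀ r, IsUnit (C r 0))
    {X₀ X : Matrix (Idx α m) (Idx α m) ℂ} (hX₀ : X₀ ∈ solutions α B C) (hd : IsUnit X₀.det)
    (hX : (X₀⁻¹ * X + 1).det ≠ 0) :
    diagToeplitz α C * cayley (X₀⁻¹ * X) ∈ skewToeplitz α m ↔ X ∈ solutions α B C := by
  set Y := X₀⁻¹ * X with hY
  have hXY : X = X₀ * Y := by rw [hY, Matrix.mul_nonsing_inv_cancel_left _ _ hd]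
  have hCu : IsUnit (diagToeplitz α C) := isUnit_diagToeplitz hC₀
  have hCd := (Matrix.isUnit_iff_isUnit_det _).1 hCu
  rw [mem_solutions_iff] at hX₀
  have hX₀T : X₀ ∈ toeplitzAlgebra α m := by
    obtain ⟨⟨A, hA⟩, -⟩ := hX₀
    exact ⟨A, hA.symm⟩
  have hYX : Y ∈ toeplitzAlgebra α m ↔ ∃ A, X = blockToeplitz α A := by
    have : X ∈ toeplitzAlgebra α m ↔ ∃ A, X = blockToeplitz α A :=
      mem_toeplitzAlgebra.trans (exists_congr fun _ => eq_comm)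
    rw [← this]
    refine ⟨fun h => ?_, fun h => mul_mem (nonsing_inv_mem_subalgebra _ hX₀T hd) h⟩
    rw [hXY]
    exact mul_mem hX₀T h
  have hKY : diagToeplitz α C * cayley Y ∈ toeplitzAlgebra α m ↔ Y ∈ toeplitzAlgebra α m := by
    constructor
    · intro h
      have hK : cayley Y ∈ toeplitzAlgebra α m := by
        rw [← Matrix.nonsing_inv_mul_cancel_left _ (cayley Y) hCd]
        exact mul_mem (nonsing_inv_mem_subalgebra _ (diagToeplitz_mem C) hCd) h
      rw [← cayleyInv_cayley hX]
      exact mul_mem (add_mem (one_mem _) hK) (nonsing_inv_mem_subalgebra _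
        (sub_mem (one_mem _) hK) (det_one_sub_cayley hX).isUnit)
    · intro h
      exact mul_mem (diagToeplitz_mem C) (mul_mem (sub_mem h (one_mem _))
        (nonsing_inv_mem_subalgebra _ (add_mem h (one_mem _)) hX.isUnit))
  have hflip : flipT (diagToeplitz α C * cayley Y) = -(diagToeplitz α C * cayley Y) ↔
      diagToeplitz α C = flipT X * (diagToeplitz α B * X) := by
    have e₁ : flipT X * (diagToeplitz α B * X) = flipT Y * diagToeplitz α C * Y := by
      conv_rhs => rw [hX₀.2]
      rw [hXY, flipT_mul]
      simp only [Matrix.mul_assoc]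
    set K := cayley Y
    set D := diagToeplitz α C with hD
    have hV : IsUnit (Y + 1) := (Matrix.isUnit_iff_isUnit_det _).2 hX.isUnit
    have hV' : IsUnit (flipT (Y + 1)) := by
      obtain ⟨V, hV⟩ := hV.exists_right_inv
      refine IsUnit.of_mul_eq_one_right (flipT V) ?_
      rw [← flipT_mul, hV, flipT_one]
    have hKV : K * (Y + 1) = Y - 1 := cayley_mul hX
    have hKV' : flipT (Y + 1) * flipT K = flipT Y - 1 := by
      rw [← flipT_mul, hKV, flipT_sub, flipT_one]
    -- Clearing denominators by the invertible factors (Y + 1)* and Y + 1 shows that the skewness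
    -- defect of D K vanishes exactly when Y* D Y = D.
    have e₂ : flipT (Y + 1) * (flipT (D * K) + D * K) * (Y + 1) =
        (2 : ℂ) • (flipT Y * D * Y - D) := by
      rw [flipT_mul, hD, flipT_diagToeplitz hC, ← hD]
      calc flipT (Y + 1) * (flipT K * D + D * K) * (Y + 1)
          = (flipT (Y + 1) * flipT K) * D * (Y + 1) + flipT (Y + 1) * D * (K * (Y + 1)) := by
            noncomm_ring
        _ = (2 : ℂ) • (flipT Y * D * Y - D) := by
            rw [hKV, hKV', flipT_add, flipT_one, two_smul]
            noncomm_ring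
    rw [e₁, ← add_eq_zero_iff_eq_neg]
    constructor
    · intro h
      rw [h, Matrix.mul_zero, Matrix.zero_mul] at e₂
      exact (sub_eq_zero.1 ((smul_eq_zero.1 e₂.symm).resolve_left two_ne_zero)).symm
    · intro h
      rw [← h, sub_self, smul_zero] at e₂
      rw [← hV'.mul_right_eq_zero, ← hV.mul_left_eq_zero]
      exact e₂
  rw [mem_solutions_iff]
  exact and_congr (hKY.trans hYX) hflip

lemma isUnit_det_of_mem_solutions {B C : DiagCoeffs m} (hC₀ : ∀ r, IsUnit (C r 0))
    {X : Matrix (Idx α m) (Idx α m) ℂ} (hX : X ∈ solutions α B C) : IsUnit X.det := by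
  have h := (Matrix.isUnit_iff_isUnit_det _).1 (isUnit_diagToeplitz (α := α) hC₀)
  rw [((mem_solutions_iff B C X).1 hX).2, Matrix.det_mul, Matrix.det_mul] at h
  exact isUnit_of_mul_isUnit_right (isUnit_of_mul_isUnit_right h)

lemma isComplexSubmanifold_solutions {B C : DiagCoeffs m}
    (hC : ∀ r, ∀ j < α r, (C r j).IsSymm) (hC₀ : ∀ r, IsUnit (C r 0)) :
    IsComplexSubmanifold (Module.finrank ℂ (skewToeplitz α m))
      {X : Idx α m → Idx α m → ℂ | Matrix.of X ∈ solutions α B C} := by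
  intro X hX
  have hCu : IsUnit (diagToeplitz α C) := isUnit_diagToeplitz hC₀
  have hd : IsUnit (Matrix.of X).det := isUnit_det_of_mem_solutions hC₀ hX
  -- The map K ↦ 𝓒 K is a linear automorphism; pulling `skewToeplitz` back along it gives the
  -- subspace that straightens the solution set.
  let e : (Idx α m → Idx α m → ℂ) ≃ₗ[ℂ] Matrix (Idx α m) (Idx α m) ℂ :=
    (Matrix.ofLinearEquiv ℂ).trans (LinearEquiv.ofBijective
      (LinearMap.mulLeft ℂ (diagToeplitz α C))
      ⟨hCu.mul_right_injective, fun Y => ⟨(diagToeplitz α C)⁻¹ * Y,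
        Matrix.mul_nonsing_inv_cancel_left _ _ ((Matrix.isUnit_iff_isUnit_det _).1 hCu)⟩⟩)
  refine ⟨cayleyChart (Matrix.of X) hd, (skewToeplitz α m).comap e.toLinearMap,
    mem_cayleyChart_source _ hd, differentiableOn_cayleyChart _ hd,
    differentiableOn_cayleyChart_symm _ hd, inferInstance, ?_, ?_⟩
  · rw [Submodule.comap_equiv_eq_map_symm]
    exact LinearEquiv.finrank_map_eq _ _
  · rw [Set.inter_comm]
    refine OpenPartialHomeomorph.IsImage.image_eq fun Y hY => ?_
    exact mem_solutions_iff_of_mem hC hC₀ hX hd hY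

end Subalgebra

/-! ### The dimension of the space of skew Toeplitz matrices -/

section Dimension

variable {N : ℕ} {α m : Fin N → ℕ}

/-- The lexicographic order of the positions `(r, i)`. -/
def PosLT (x y : (r : Fin N) × Fin (m r)) : Prop :=
  x.1 < y.1 ∨ (x.1 = y.1 ∧ x.2.val < y.2.val)

instance : DecidableRel (PosLT (m := m)) := fun _ _ => inferInstanceAs (Decidable (_ ∨ _))

lemma PosLT.le {x y : (r : Fin N) × Fin (m r)} (h : PosLT x y) : x.1 ≤ y.1 := by
  rcases h with h | h
  · exact h.le
  · exact h.1.le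

lemma PosLT.asymm {x y : (r : Fin N) × Fin (m r)} (h : PosLT x y) : ¬ PosLT y x := by
  unfold PosLT at *
  rw [Fin.lt_def, Fin.ext_iff] at *
  omega

lemma posLT_trichotomy (x y : (r : Fin N) × Fin (m r)) : PosLT x y ∨ x = y ∨ PosLT y x := by
  obtain ⟨r, i⟩ := x
  obtain ⟨s, k⟩ := y
  rcases lt_trichotomy r s with h | rfl | h
  · exact Or.inl (Or.inl h)
  · rcases lt_trichotomy i k with h | rfl | h
    · exact Or.inl (Or.inr ⟨rfl, h⟩)
    · exact Or.inr (Or.inl rfl)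
    · exact Or.inr (Or.inr (Or.inr ⟨rfl, h⟩))
  · exact Or.inr (Or.inr (Or.inl h))

/-- The positions of the independent entries of a matrix in `skewToeplitz α m`. -/
abbrev SkewIdx (α m : Fin N → ℕ) :=
  (x : (r : Fin N) × Fin (m r)) × (Fin (α x.1) × {y : (r : Fin N) × Fin (m r) // PosLT y x})

/-- The coefficients of the matrix in `skewToeplitz α m` with given independent entries. -/
def skewCoeffs (g : SkewIdx α m → ℂ) : Coeffs m := fun r s n i k =>
  if h : PosLT ⟨s, k⟩ ⟨r, i⟩ ∧ n < α r then g ⟨⟨r, i⟩, ⟨n, h.2⟩, ⟨⟨s, k⟩, h.1⟩⟩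
  else if h : PosLT ⟨r, i⟩ ⟨s, k⟩ ∧ n < α s then -g ⟨⟨s, k⟩, ⟨n, h.2⟩, ⟨⟨r, i⟩, h.1⟩⟩
  else 0

lemma skewCoeffs_of_posLT (g : SkewIdx α m → ℂ) {r s : Fin N} {n : ℕ} {i : Fin (m r)}
    {k : Fin (m s)} (h : PosLT ⟨s, k⟩ ⟨r, i⟩) (hn : n < α r) :
    skewCoeffs g r s n i k = g ⟨⟨r, i⟩, ⟨n, hn⟩, ⟨⟨s, k⟩, h⟩⟩ := by
  rw [skewCoeffs, dif_pos ⟨h, hn⟩]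

lemma skewCoeffs_of_posLT' (g : SkewIdx α m → ℂ) {r s : Fin N} {n : ℕ} {i : Fin (m r)}
    {k : Fin (m s)} (h : PosLT ⟨r, i⟩ ⟨s, k⟩) (hn : n < α s) :
    skewCoeffs g r s n i k = -g ⟨⟨s, k⟩, ⟨n, hn⟩, ⟨⟨r, i⟩, h⟩⟩ := by
  rw [skewCoeffs, dif_neg fun h' => h.asymm h'.1, dif_pos ⟨h, hn⟩]

lemma skewCoeffs_diag (g : SkewIdx α m → ℂ) (r : Fin N) (n : ℕ) (i : Fin (m r)) :
    skewCoeffs g r r n i i = 0 := by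
  rw [skewCoeffs, dif_neg fun h => h.1.asymm h.1, dif_neg fun h => h.1.asymm h.1]

/-- The parametrization of `skewToeplitz α m` by the independent entries. -/
def skewParam (α m : Fin N → ℕ) :
    (SkewIdx α m → ℂ) →ₗ[ℂ] Matrix (Idx α m) (Idx α m) ℂ where
  toFun g := blockToeplitz α (skewCoeffs g)
  map_add' g g' := by
    rw [← blockToeplitz_add]
    congr 1
    funext r s n i k
    change _ = skewCoeffs g r s n i k + skewCoeffs g' r s n i k
    unfold skewCoeffs
    split_ifs
    · rfl
    · rw [← neg_add]; rfl
    · rw [add_zero]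
  map_smul' c g := by
    rw [RingHom.id_apply, ← blockToeplitz_smul]
    congr 1
    funext r s n i k
    change _ = c * skewCoeffs g r s n i k
    unfold skewCoeffs
    split_ifs
    · rfl
    · rw [mul_neg]; rfl
    · rw [mul_zero]

/-- If y precedes x, then the block of y has at least as many coefficients as that of x, so all `α
x.1` coefficients really occur in the matrix. -/
lemma skewParam_injective (hα : StrictAnti α) : Function.Injective (skewParam α m) := by
  intro g g' h
  funext t
  obtain ⟨⟨r, i⟩, ⟨n, hn⟩, ⟨⟨s, k⟩, hlt⟩⟩ := t
  have h' := blockToeplitz_inj.1 h r s n hn (hn.trans_le (hα.antitone hlt.le))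
  have := congrFun (congrFun h' i) k
  rwa [skewCoeffs_of_posLT g hlt hn, skewCoeffs_of_posLT g' hlt hn] at this

/-- Skewness means A_n^{sr} = -(A_n^{rs})ᵀ, so the entries at positions (x, y) with y before x
determine the rest, and the entries with x = y vanish. -/
lemma range_skewParam :
    LinearMap.range (skewParam α m) = skewToeplitz α m := by
  apply le_antisymm
  · rintro _ ⟨g, rfl⟩
    refine ⟨⟨skewCoeffs g, rfl⟩, ?_⟩
    change flipT (blockToeplitz α (skewCoeffs g)) = -blockToeplitz α (skewCoeffs g)
    rw [flipT_blockToeplitz, ← neg_one_smul ℂ (blockToeplitz α (skewCoeffs g)),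
      ← blockToeplitz_smul, blockToeplitz_inj]
    intro r s n hr hs
    ext i k
    change skewCoeffs g s r n k i = -1 * skewCoeffs g r s n i k
    rw [neg_one_mul]
    rcases posLT_trichotomy (⟨s, k⟩ : (r : Fin N) × Fin (m r)) ⟨r, i⟩ with h | h | h
    · rw [skewCoeffs_of_posLT g h hr, skewCoeffs_of_posLT' g h hr]
    · cases h
      rw [skewCoeffs_diag, neg_zero]
    · rw [skewCoeffs_of_posLT g h hs, skewCoeffs_of_posLT' g h hs, neg_neg]
  · rintro _ ⟨⟨A, rfl⟩, hA⟩
    rw [flipT_blockToeplitz, ← neg_one_smul ℂ (blockToeplitz α A), ← blockToeplitz_smul,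
      blockToeplitz_inj] at hA
    have hA' : ∀ r s n, n < α r → n < α s → ∀ i k, A s r n k i = -A r s n i k := by
      intro r s n hr hs i k
      have := congrFun (congrFun (hA r s n hr hs) i) k
      change A s r n k i = -1 * A r s n i k at this
      rwa [neg_one_mul] at this
    refine ⟨fun t => A t.1.1 t.2.2.1.1 t.2.1 t.1.2 t.2.2.1.2, blockToeplitz_inj.2 ?_⟩
    intro r s n hr hs
    ext i k
    rcases posLT_trichotomy (⟨s, k⟩ : (r : Fin N) × Fin (m r)) ⟨r, i⟩ with h | h | h
    · rw [skewCoeffs_of_posLT _ h hr]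
    · cases h
      rw [skewCoeffs_diag]
      exact (self_eq_neg.1 (hA' r r n hr hr i i)).symm
    · rw [skewCoeffs_of_posLT' _ h hs, hA' r s n hr hs, neg_neg]

/-- The positions before (r, i) are the i earlier ones in block r and all those in earlier blocks.
Summing i over block r gives m_r (m_r - 1)/2 in the dimension formula. -/
lemma card_posLT (x : (r : Fin N) × Fin (m r)) :
    Fintype.card {y : (r : Fin N) × Fin (m r) // PosLT y x} =
      x.2.val + ∑ s ∈ Finset.Iio x.1, m s := by
  obtain ⟨r, i⟩ := x
  rw [Fintype.card_subtype, Finset.card_filter, Fintype.sum_sigma, sum_univ_eq_Iio_add_Ioi _ r]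
  have h₁ : ∑ k : Fin (m r), (if PosLT ⟨r, k⟩ ⟨r, i⟩ then 1 else 0) = i.val := by
    have : ∀ k : Fin (m r), PosLT ⟨r, k⟩ ⟨r, i⟩ ↔ k < i := fun k => by
      simp [PosLT]
    simp only [this]
    rw [← Finset.card_filter, Finset.filter_gt_eq_Iio, Fin.card_Iio]
  have h₂ : ∀ s ∈ Finset.Iio r, ∑ k : Fin (m s), (if PosLT ⟨s, k⟩ ⟨r, i⟩ then 1 else 0) = m s := by
    intro s hs
    have : ∀ k : Fin (m s), PosLT ⟨s, k⟩ ⟨r, i⟩ := fun k => Or.inl (Finset.mem_Iio.1 hs)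
    simp [this]
  have h₃ : ∀ s ∈ Finset.Ioi r, ∑ k : Fin (m s), (if PosLT ⟨s, k⟩ ⟨r, i⟩ then 1 else 0) = 0 := by
    intro s hs
    have : ∀ k : Fin (m s), ¬ PosLT ⟨s, k⟩ ⟨r, i⟩ := fun k h =>
      absurd h.le (not_le.2 (Finset.mem_Ioi.1 hs))
    simp [this]
  rw [h₁, Finset.sum_congr rfl h₂, Finset.sum_congr rfl h₃]
  simp

lemma sum_range_cast_rat (n : ℕ) : ∑ i ∈ Finset.range n, (i : ℚ) = n * ((n : ℚ) - 1) / 2 := by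
  induction n with
  | zero => simp
  | succ n ih => rw [Finset.sum_range_succ, ih]; push_cast; ring

lemma finrank_skewToeplitz (hα : StrictAnti α) :
    (Module.finrank ℂ (skewToeplitz α m) : ℚ) =
      ∑ r, (α r : ℚ) * m r * (((m r : ℚ) - 1) / 2 + ∑ s ∈ Finset.Iio r, (m s : ℚ)) := by
  rw [← range_skewParam, LinearMap.finrank_range_of_inj (skewParam_injective hα),
    Module.finrank_fintype_fun_eq_card, Fintype.card_sigma, Fintype.sum_sigma]
  simp only [Fintype.card_prod, Fintype.card_fin, card_posLT]
  push_cast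
  refine Finset.sum_congr rfl fun r _ => ?_
  rw [← Finset.mul_sum, Finset.sum_add_distrib, mul_assoc]
  have h : ∑ i : Fin (m r), (i.val : ℚ) = m r * ((m r : ℚ) - 1) / 2 := by
    rw [Fin.sum_univ_eq_sum_range (fun i => (i : ℚ)), sum_range_cast_rat]
  rw [h]
  simp only [Finset.sum_const, Finset.card_univ, Fintype.card_fin, nsmul_eq_mul]
  ring

end Dimension

/-! ### Existence of solutions and of real solutions -/

section

variable {N : ℕ} {α m : Fin N → ℕ}

lemma isRealMatrix_zero {p q : Type*} : IsRealMatrix (0 : Matrix p q ℂ) := fun _ _ => rfl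

/-- The choice of data with given `A_0^{rr}` and all other matrices zero. -/
def Params.ofDiag (α : Fin N → ℕ) (A : ∀ r, Matrix (Fin (m r)) (Fin (m r)) ℂ) : Params α m where
  diag := A
  lower _ _ _ _ _ := 0
  skew _ _ _ _ := 0

lemma Params.ofDiag_admissible {B C : DiagCoeffs m} {A : ∀ r, Matrix (Fin (m r)) (Fin (m r)) ℂ}
    (hA : ∀ r, C r 0 = (A r)ᵀ * B r 0 * A r) : (Params.ofDiag α A).Admissible B C :=
  ⟨hA, fun _ _ _ _ => by simp [Params.ofDiag]⟩

/-- Over ℂ the congruences for the A_0^{rr} are always solvable, and all other data may be zero. -/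
lemma solutions_nonempty (hα : StrictAnti α) (hα_pos : ∀ r, 0 < α r) {B C : DiagCoeffs m}
    (hB : ∀ r, ∀ j < α r, (B r j).IsSymm) (hC : ∀ r, ∀ j < α r, (C r j).IsSymm)
    (hB₀ : ∀ r, IsUnit (B r 0)) (hC₀ : ∀ r, IsUnit (C r 0)) : (solutions α B C).Nonempty := by
  choose A hA using fun r => exists_congruence_complex (hC r 0 (hα_pos r)) (hB r 0 (hα_pos r))
    (hC₀ r) (hB₀ r)
  exact ⟨_, (bijOn_algorithm hα hα_pos hB hC hC₀).mapsTo (Params.ofDiag_admissible hA)⟩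

lemma isRealMatrix_coeff_zero (hα_pos : ∀ r, 0 < α r) {B : DiagCoeffs m}
    (hB : IsRealMatrix (diagToeplitz α B)) (r : Fin N) : IsRealMatrix (B r 0) := by
  rw [isRealMatrix_diagToeplitz_iff] at hB
  exact isRealMatrix_iff.2 (hB r 0 (hα_pos r)).symm

/-- Real data can be chosen only if the inertias agree. -/
lemma inertia_eq_of_isReal (hα_pos : ∀ r, 0 < α r) {B C : DiagCoeffs m}
    (hB : ∀ r, ∀ j < α r, (B r j).IsSymm) (hC : ∀ r, ∀ j < α r, (C r j).IsSymm)
    (hB₀ : ∀ r, IsUnit (B r 0)) (hC₀ : ∀ r, IsUnit (C r 0))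
    (hBr : IsRealMatrix (diagToeplitz α B)) (hCr : IsRealMatrix (diagToeplitz α C))
    {P : Params α m} (hP : P.Admissible B C) (hPr : P.IsReal) (r : Fin N) :
    inertia (B r 0) = inertia (C r 0) :=
  (exists_real_congruence_iff (hB r 0 (hα_pos r)) (hC r 0 (hα_pos r)) (hB₀ r) (hC₀ r)
    (isRealMatrix_coeff_zero hα_pos hBr r) (isRealMatrix_coeff_zero hα_pos hCr r)).1
    ⟨P.diag r, hPr.1 r, hP.1 r⟩

/-- A real solution has real data, in particular real A_0^{rr}, which forces equal inertias.
Conversely Sylvester's law provides real A_0^{rr}, and zero is a real choice for the rest. -/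
lemma exists_real_solution_iff (hα : StrictAnti α) (hα_pos : ∀ r, 0 < α r) {B C : DiagCoeffs m}
    (hB : ∀ r, ∀ j < α r, (B r j).IsSymm) (hC : ∀ r, ∀ j < α r, (C r j).IsSymm)
    (hB₀ : ∀ r, IsUnit (B r 0)) (hC₀ : ∀ r, IsUnit (C r 0))
    (hBr : IsRealMatrix (diagToeplitz α B)) (hCr : IsRealMatrix (diagToeplitz α C)) :
    (∃ X ∈ solutions α B C, IsRealMatrix X) ↔ ∀ r, inertia (B r 0) = inertia (C r 0) := by
  have hbij := bijOn_algorithm hα hα_pos hB hC hC₀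
  constructor
  · rintro ⟨X, hX, hXr⟩
    obtain ⟨P, hP, rfl⟩ := hbij.surjOn hX
    exact inertia_eq_of_isReal hα_pos hB hC hB₀ hC₀ hBr hCr hP
      ((isRealMatrix_algorithm_iff hα hα_pos hC₀ hBr hCr hP).1 hXr)
  · intro h
    choose A hAr hA using fun r => (exists_real_congruence_iff (hB r 0 (hα_pos r))
      (hC r 0 (hα_pos r)) (hB₀ r) (hC₀ r) (isRealMatrix_coeff_zero hα_pos hBr r)
      (isRealMatrix_coeff_zero hα_pos hCr r)).2 (h r)
    have hP : (Params.ofDiag α A).Admissible B C := Params.ofDiag_admissible hA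
    exact ⟨_, hbij.mapsTo hP, (isRealMatrix_algorithm_iff hα hα_pos hC₀ hBr hCr hP).2
      ⟨hAr, fun _ _ _ _ _ => isRealMatrix_zero, fun _ _ _ _ => isRealMatrix_zero⟩⟩

end

end ToeplitzEq

theorem lemma3p1 {N : ℕ} (α m : Fin N → ℕ) (hα : StrictAnti α) (hα_pos : ∀ r, 0 < α r)
    (B C : ToeplitzEq.DiagCoeffs m)
    (hB : ∀ r, ∀ j < α r, (B r j).IsSymm) (hC : ∀ r, ∀ j < α r, (C r j).IsSymm)
    (hB₀ : ∀ r, IsUnit (B r 0)) (hC₀ : ∀ r, IsUnit (C r 0)) :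
    -- the dimension of the (nonempty) set of solutions
    ((ToeplitzEq.solutions α B C).Nonempty ∧
      ∃ d : ℕ,
        (d : ℚ) = ∑ r, (α r : ℚ) * m r * (((m r : ℚ) - 1) / 2 + ∑ s ∈ Finset.Iio r, (m s : ℚ)) ∧
        ToeplitzEq.IsComplexSubmanifold d
          {X : ToeplitzEq.Idx α m → ToeplitzEq.Idx α m → ℂ |
            Matrix.of X ∈ ToeplitzEq.solutions α B C}) ∧
    -- the algorithm puts the admissible choices in bijection with the solutions
    Set.BijOn
      (fun P : ToeplitzEq.Params α m =>
        ToeplitzEq.blockToeplitz α (ToeplitzEq.algorithm B C P))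
      {P | P.Admissible B C} (ToeplitzEq.solutions α B C) ∧
    -- it keeps the chosen blocks, and the remaining ones are given by the stated formulas
    (∀ P : ToeplitzEq.Params α m, P.Admissible B C →
      (∀ r, ToeplitzEq.algorithm B C P r r 0 = P.diag r) ∧
      (∀ r s j (h₁ : s < r) (h₂ : j < α r),
        ToeplitzEq.algorithm B C P r s j = P.lower r s j h₁ h₂) ∧
      (∀ r j (h₁ : 1 ≤ j) (h₂ : j < α r),
        ToeplitzEq.algorithm B C P r r j =
          ToeplitzEq.diagFormula α B C (ToeplitzEq.algorithm B C P) r j (P.skew r j h₁ h₂)) ∧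
      (∀ r s j, r < s → j < α s →
        ToeplitzEq.algorithm B C P r s j =
          ToeplitzEq.upperFormula α B C (ToeplitzEq.algorithm B C P) r s j)) ∧
    -- real solutions
    (ToeplitzEq.IsRealMatrix (ToeplitzEq.diagToeplitz α B) →
      ToeplitzEq.IsRealMatrix (ToeplitzEq.diagToeplitz α C) →
      ((∃ X ∈ ToeplitzEq.solutions α B C, ToeplitzEq.IsRealMatrix X) ↔
        ∀ r, ToeplitzEq.inertia (B r 0) = ToeplitzEq.inertia (C r 0)) ∧
      ∀ P : ToeplitzEq.Params α m, P.Admissible B C →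
        (ToeplitzEq.IsRealMatrix
            (ToeplitzEq.blockToeplitz α (ToeplitzEq.algorithm B C P)) ↔
          (∀ r, ToeplitzEq.inertia (B r 0) = ToeplitzEq.inertia (C r 0)) ∧ P.IsReal)) := by
  refine ⟨⟨ToeplitzEq.solutions_nonempty hα hα_pos hB hC hB₀ hC₀, _,
      ToeplitzEq.finrank_skewToeplitz hα, ToeplitzEq.isComplexSubmanifold_solutions hC hC₀⟩,
    ToeplitzEq.bijOn_algorithm hα hα_pos hB hC hC₀, fun P _ => ?_, fun hBr hCr =>
    ⟨ToeplitzEq.exists_real_solution_iff hα hα_pos hB hC hB₀ hC₀ hBr hCr, fun P hP => ?_⟩⟩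
  · have h := ToeplitzEq.follows_algorithm hα B C P
    exact ⟨h.diag_zero, h.lower, h.diag, h.upper⟩
  · rw [ToeplitzEq.isRealMatrix_algorithm_iff hα hα_pos hC₀ hBr hCr hP]
    exact ⟨fun h => ⟨ToeplitzEq.inertia_eq_of_isReal hα_pos hB hC hB₀ hC₀ hBr hCr hP h, h⟩,
      fun h => h.2⟩
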